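/- Let $P$ be a quantum $WCF(1/2,\varepsilon)$ protocol with $N$ rounds. Then for every $z\in[0,1]$ and every $k\in\mathbb N$ there is a $WCF(x,\varepsilon_0)$ protocol $Q$ that uses $k\cdot N$ rounds and satisfies $|x-z|\le 2^{-k}$ and $\varepsilon_0\le 2\varepsilon$. Moreover, $Q$ can be obtained from the two trivial protocols without communication (Alice always wins; Bob always wins) by finitely many applications of the operation $(P_1,P_2)\mapsto \mathrm{Comb}(P_1,P_2)$. Here a coin flipping protocol is a finite-dimensional quantum interaction between Alice and Bob, who have private memories in independent initial states and exchange a message register; a round is a message from Alice to Bob followed by a message from Bob to Alice. At the end Alice outputs $c_A$ and Bob outputs $c_B$ in $\{0,1,\mathrm{Abort}\}$; the outcome is $c=c_A$ if $c_A=c_B$ and Abort otherwise. Alice wins if $c=0$ and Bob wins if $c=1$. A cheating player may use any finite-dimensional memory and any quantum operations, and outputs any value. The protocol is a $WCF(z,\varepsilon)$ protocol if (i) when both players are honest, $\Pr[\text{Alice wins}]=z$ and $\Pr[\text{Bob wins}]=1-z$; (ii) for every cheating Alice against honest Bob, $\Pr[\text{Alice wins}]\le z+\varepsilon$; (iii)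 for every cheating Bob against honest Alice, $\Pr[\text{Bob wins}]\le (1-z)+\varepsilon$. The protocol $\mathrm{Comb}(P_1,P_2)$ is: run $P$; if Alice wins, run $P_2$; if Bob wins, run $P_1$; if $P$ aborts, abort (an honest player decides this by its own output of $P$). -/

import Mathlib

open scoped Matrix Kronecker ComplexOrder

noncomputable section

namespace CoinFlip

/-! Finite-dimensional quantum systems.  A system with basis indexed by a finite type `S` has
states the density matrices in `Matrix S S ℂ`; a composite system is indexed by a product type. -/

/-- `ρ` is a density matrix. -/
structure IsDensity {S : Type} [Fintype S] (ρ : Matrix S S ℂ) : Prop where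
  posSemidef : ρ.PosSemidef
  trace_eq : ρ.trace = 1

theorem IsDensity.kronecker {S T : Type} [Fintype S] [Fintype T]
    {ρ : Matrix S S ℂ} {σ : Matrix T T ℂ} (hρ : IsDensity ρ) (hσ : IsDensity σ) :
    IsDensity (ρ ⊗ₖ σ) :=
  ⟨hρ.posSemidef.kronecker hσ.posSemidef, by
    rw [Matrix.trace_kronecker, hρ.trace_eq, hσ.trace_eq, mul_one]⟩

/-- The pure state `|s⟩⟨s|` of the computational basis. -/
def ket {S : Type} [DecidableEq S] (s : S) : Matrix S S ℂ := Matrix.single s s 1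

/-- A quantum operation (completely positive trace-preserving map) on the system `S`, given by
Kraus operators. -/
structure Channel (S : Type) [Fintype S] [DecidableEq S] where
  /-- index set of the Kraus operators -/
  Idx : Type
  [fintypeIdx : Fintype Idx]
  /-- the Kraus operators -/
  kraus : Idx → Matrix S S ℂ
  tracePreserving : ∑ i, (kraus i)ᴴ * kraus i = 1

attribute [instance] Channel.fintypeIdx

namespace Channel

variable {S T R : Type} [Fintype S] [DecidableEq S] [Fintype T] [DecidableEq T]
  [Fintype R] [DecidableEq R]

/-- The action `ρ ↦ ∑ᵢ Kᵢ ρ Kᵢ†` of a quantum operation on states. -/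
def apply (Φ : Channel S) (ρ : Matrix S S ℂ) : Matrix S S ℂ :=
  ∑ i, Φ.kraus i * ρ * (Φ.kraus i)ᴴ

/-- Do nothing. -/
def id (S : Type) [Fintype S] [DecidableEq S] : Channel S where
  Idx := Unit
  kraus := fun _ => 1
  tracePreserving := by simp

/-- First `Φ`, then `Ψ`. -/
def andThen (Φ Ψ : Channel S) : Channel S where
  Idx := Φ.Idx × Ψ.Idx
  kraus := fun p => Ψ.kraus p.2 * Φ.kraus p.1
  tracePreserving := by
    rw [Fintype.sum_prod_type]
    have h : ∀ i : Φ.Idx, ∑ j : Ψ.Idx, (Ψ.kraus j * Φ.kraus i)ᴴ * (Ψ.kraus j * Φ.kraus i)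
        = (Φ.kraus i)ᴴ * Φ.kraus i := by
      intro i
      have h2 : ∀ j : Ψ.Idx, (Ψ.kraus j * Φ.kraus i)ᴴ * (Ψ.kraus j * Φ.kraus i)
          = (Φ.kraus i)ᴴ * ((Ψ.kraus j)ᴴ * Ψ.kraus j) * Φ.kraus i := by
        intro j
        simp only [Matrix.conjTranspose_mul, Matrix.mul_assoc]
      simp only [h2]
      rw [← Finset.sum_mul, ← Finset.mul_sum, Ψ.tracePreserving, mul_one]
    simp only [h]
    exact Φ.tracePreserving

/-- Apply `Φ` to the subsystem `T` of a system `S` that factors, through `e`, as `T ⊗ R`;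
nothing happens to `R`. -/
def onPart (e : S ≃ T × R) (Φ : Channel T) : Channel S where
  Idx := Φ.Idx
  kraus := fun i => (Φ.kraus i ⊗ₖ (1 : Matrix R R ℂ)).submatrix e e
  tracePreserving := by
    have h : ∀ i, ((Φ.kraus i ⊗ₖ (1 : Matrix R R ℂ)).submatrix e e)ᴴ *
        (Φ.kraus i ⊗ₖ (1 : Matrix R R ℂ)).submatrix e e =
        (((Φ.kraus i)ᴴ * Φ.kraus i) ⊗ₖ (1 : Matrix R R ℂ)).submatrix e e := by
      intro i
      rw [Matrix.conjTranspose_submatrix, Matrix.submatrix_mul_equiv,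
        Matrix.conjTranspose_kronecker, ← Matrix.mul_kronecker_mul]
      simp
    simp only [h]
    ext a b
    have h3 := congrFun (congrFun Φ.tracePreserving (e a).1) (e b).1
    rw [Matrix.sum_apply] at h3
    rw [Matrix.sum_apply]
    simp only [Matrix.submatrix_apply, Matrix.kroneckerMap_apply]
    rw [← Finset.sum_mul, h3]
    have h4 := congrFun (congrFun (Matrix.one_kronecker_one (α := ℂ) (m := T) (n := R)) (e a)) (e b)
    rw [Matrix.kroneckerMap_apply] at h4
    rw [h4, Matrix.one_apply, Matrix.one_apply]
    simp

/-- Measure the value of `f` (in the computational basis) and, when the result is `o`, apply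
`Φ o`. -/
def measureThen {O : Type} [Fintype O] [DecidableEq O] (f : S → O) (Φ : O → Channel S) :
    Channel S where
  Idx := Σ o : O, (Φ o).Idx
  kraus := fun p => (Φ p.1).kraus p.2 * Matrix.diagonal (fun s => if f s = p.1 then 1 else 0)
  tracePreserving := by
    rw [Fintype.sum_sigma]
    have h : ∀ o : O, ∑ j : (Φ o).Idx,
        ((Φ o).kraus j * Matrix.diagonal (fun s => if f s = o then (1 : ℂ) else 0))ᴴ *
          ((Φ o).kraus j * Matrix.diagonal (fun s => if f s = o then (1 : ℂ) else 0)) =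
        Matrix.diagonal (fun s => if f s = o then (1 : ℂ) else 0) := by
      intro o
      have h2 : ∀ j : (Φ o).Idx,
          ((Φ o).kraus j * Matrix.diagonal (fun s => if f s = o then (1 : ℂ) else 0))ᴴ *
            ((Φ o).kraus j * Matrix.diagonal (fun s => if f s = o then (1 : ℂ) else 0)) =
          (Matrix.diagonal (fun s => if f s = o then (1 : ℂ) else 0))ᴴ *
            (((Φ o).kraus j)ᴴ * (Φ o).kraus j) *
            Matrix.diagonal (fun s => if f s = o then (1 : ℂ) else 0) := by
        intro j
        simp only [Matrix.conjTranspose_mul, Matrix.mul_assoc]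
      simp only [h2]
      rw [← Finset.sum_mul, ← Finset.mul_sum, (Φ o).tracePreserving, mul_one,
        Matrix.diagonal_conjTranspose, Matrix.diagonal_mul_diagonal]
      congr 1
      funext s
      by_cases hs : f s = o <;> simp [hs]
    simp only [h]
    ext a b
    rw [Matrix.sum_apply, Matrix.one_apply]
    by_cases hab : a = b
    · subst hab
      simp
    · simp [hab]

/-- Discard the state of the system and replace it by `|s⟩⟨s|`. -/
def reset (s : S) : Channel S where
  Idx := S
  kraus := fun t => Matrix.single s t 1
  tracePreserving := by
    ext a b
    rw [Matrix.sum_apply, Matrix.one_apply]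
    by_cases hab : a = b
    · subst hab
      simp [Matrix.conjTranspose_single, Matrix.single_apply]
    · simp only [Matrix.conjTranspose_single, Matrix.single_mul_single_same, Matrix.single_apply,
        hab, if_false]
      exact Finset.sum_eq_zero fun x _ => if_neg fun h => hab (h.1.symm.trans h.2)

end Channel

/-- The value that a player outputs. -/
inductive Outcome where
  | zero
  | one
  | abort
  deriving DecidableEq

instance : Fintype Outcome where
  elems := {Outcome.zero, Outcome.one, Outcome.abort}
  complete := by intro c; cases c <;> simp

/-- The (honest or cheating) behaviour of one player in an interaction through a message register
with basis `Msg`: a private memory `Mem` of any finite dimension, its initial state, the quantum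
operation `op i` that the player applies to the memory and the message register when holding the
register for the `i`-th time (`i = 0, 1, …`), and the value that the player outputs at the end, read
off a measurement of the memory in the computational basis. -/
structure Player (Msg : Type) [Fintype Msg] [DecidableEq Msg] where
  Mem : Type
  [fintypeMem : Fintype Mem]
  [decEqMem : DecidableEq Mem]
  init : Matrix Mem Mem ℂ
  init_isDensity : IsDensity init
  op : ℕ → Channel (Mem × Msg)
  out : Mem → Outcome

attribute [instance] Player.fintypeMem Player.decEqMem

namespace Player

variable {Msg : Type} [Fintype Msg] [DecidableEq Msg]

/-- In the joint system (Alice's memory, message register, Bob's memory), Alice acts on the first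
two factors. -/
def aliceView (A M B : Type) : (A × M) × B ≃ (A × M) × B := Equiv.refl _

/-- In the joint system (Alice's memory, message register, Bob's memory), Bob acts on the last
two factors. -/
def bobView (A M B : Type) : (A × M) × B ≃ (B × M) × A where
  toFun s := ((s.2, s.1.2), s.1.1)
  invFun t := ((t.2, t.1.2), t.1.1)
  left_inv _ := rfl
  right_inv _ := rfl

/-- The joint state of Alice's memory, the message register and Bob's memory after `r` rounds.
The players start in independent states and the message register is blank; in each round Alice
acts and sends the register to Bob, then Bob acts and sends it to Alice. -/
def stateAfter (blank : Msg) (A B : Player Msg) :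
    ℕ → Matrix ((A.Mem × Msg) × B.Mem) ((A.Mem × Msg) × B.Mem) ℂ
  | 0 => (A.init ⊗ₖ ket blank) ⊗ₖ B.init
  | r + 1 => ((B.op r).onPart (bobView A.Mem Msg B.Mem)).apply
      (((A.op r).onPart (aliceView A.Mem Msg B.Mem)).apply (stateAfter blank A B r))

/-- The joint state at the end of an `n`-round interaction: Alice has also processed the last
message. -/
def finalState (n : ℕ) (blank : Msg) (A B : Player Msg) :
    Matrix ((A.Mem × Msg) × B.Mem) ((A.Mem × Msg) × B.Mem) ℂ :=
  ((A.op n).onPart (aliceView A.Mem Msg B.Mem)).apply (stateAfter blank A B n)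

/-- The probability that, at the end of an `n`-round interaction, both players output `c`. -/
def probBoth (n : ℕ) (blank : Msg) (A B : Player Msg) (c : Outcome) : ℝ :=
  ∑ s : (A.Mem × Msg) × B.Mem,
    if A.out s.1.1 = c ∧ B.out s.2 = c then (finalState n blank A B s s).re else 0

end Player

/-- A quantum coin flipping protocol: a message register with a blank state, a number of rounds
(a round is a message from Alice to Bob followed by a message from Bob to Alice), and the
prescribed behaviours of Alice and Bob.  Bob uses `op i` for `i < rounds`, and Alice uses `op i`
for `i ≤ rounds`, where `op rounds` processes the last message she receives. -/
structure Protocol where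
  Msg : Type
  [fintypeMsg : Fintype Msg]
  [decEqMsg : DecidableEq Msg]
  blank : Msg
  rounds : ℕ
  alice : Player Msg
  bob : Player Msg

attribute [instance] Protocol.fintypeMsg Protocol.decEqMsg

namespace Protocol

/-- The probability that the protocol outputs `c = 0`, i.e. that Alice wins, when the two players
behave as `A` and `B`. -/
def probAliceWins (P : Protocol) (A B : Player P.Msg) : ℝ :=
  Player.probBoth P.rounds P.blank A B Outcome.zero

/-- The probability that the protocol outputs `c = 1`, i.e. that Bob wins, when the two players
behave as `A` and `B`. -/
def probBobWins (P : Protocol) (A B : Player P.Msg) : ℝ :=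
  Player.probBoth P.rounds P.blank A B Outcome.one

/-- `P` is a weak coin flipping protocol with parameter `z` and bias `ε`. -/
structure IsWCF (P : Protocol) (z ε : ℝ) : Prop where
  honest_alice : P.probAliceWins P.alice P.bob = z
  honest_bob : P.probBobWins P.alice P.bob = 1 - z
  cheating_alice : ∀ A : Player P.Msg, P.probAliceWins A P.bob ≤ z + ε
  cheating_bob : ∀ B : Player P.Msg, P.probBobWins P.alice B ≤ (1 - z) + ε

/-- The player that has no memory, does nothing, and outputs `c`. -/
def constPlayer (c : Outcome) : Player Unit where
  Mem := Unit
  init := ket ()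
  init_isDensity := ⟨by
    have h : (ket () : Matrix Unit Unit ℂ) = 1 := by ext; simp [ket]
    rw [h]; exact Matrix.PosSemidef.one, by simp [ket]⟩
  op _ := Channel.id _
  out _ := c

/-- The protocol without communication in which both players output `c`: for `c = 0` Alice always
wins, for `c = 1` Bob always wins. -/
def const (c : Outcome) : Protocol where
  Msg := Unit
  blank := ()
  rounds := 0
  alice := constPlayer c
  bob := constPlayer c

section Comb

variable {A A₁ A₂ M M₁ M₂ : Type}

/-- The part (memory, message) belonging to the first protocol. -/
def part₀ (A A₁ A₂ M M₁ M₂ : Type) :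
    (A × A₁ × A₂) × (M × M₁ × M₂) ≃ (A × M) × ((A₁ × A₂) × (M₁ × M₂)) where
  toFun s := ((s.1.1, s.2.1), (s.1.2, s.2.2))
  invFun t := ((t.1.1, t.2.1), (t.1.2, t.2.2))
  left_inv _ := rfl
  right_inv _ := rfl

/-- The part (memory, message) belonging to the second protocol. -/
def part₁ (A A₁ A₂ M M₁ M₂ : Type) :
    (A × A₁ × A₂) × (M × M₁ × M₂) ≃ (A₁ × M₁) × ((A × A₂) × (M × M₂)) where
  toFun s := ((s.1.2.1, s.2.2.1), ((s.1.1, s.1.2.2), (s.2.1, s.2.2.2)))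
  invFun t := ((t.2.1.1, (t.1.1, t.2.1.2)), (t.2.2.1, (t.1.2, t.2.2.2)))
  left_inv _ := rfl
  right_inv _ := rfl

/-- The part (memory, message) belonging to the third protocol. -/
def part₂ (A A₁ A₂ M M₁ M₂ : Type) :
    (A × A₁ × A₂) × (M × M₁ × M₂) ≃ (A₂ × M₂) × ((A × A₁) × (M × M₁)) where
  toFun s := ((s.1.2.2, s.2.2.2), ((s.1.1, s.1.2.1), (s.2.1, s.2.2.1)))
  invFun t := ((t.2.1.1, (t.2.1.2, t.1.1)), (t.2.2.1, (t.2.2.2, t.1.2)))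
  left_inv _ := rfl
  right_inv _ := rfl

/-- The message registers of the second and third protocols. -/
def partMsgs (A A₁ A₂ M M₁ M₂ : Type) :
    (A × A₁ × A₂) × (M × M₁ × M₂) ≃ (M₁ × M₂) × ((A × A₁ × A₂) × M) where
  toFun s := (s.2.2, (s.1, s.2.1))
  invFun t := (t.2.1, (t.2.2, t.1))
  left_inv _ := rfl
  right_inv _ := rfl

end Comb

section Comb

variable {M M₁ M₂ : Type} [Fintype M] [DecidableEq M] [Fintype M₁] [DecidableEq M₁]
  [Fintype M₂] [DecidableEq M₂]

/-- The memory of a player of `Comb(P₁, P₂)`: one memory for each of `P`, `P₁`, `P₂`. -/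
abbrev CombMem (X : Player M) (X₁ : Player M₁) (X₂ : Player M₂) : Type :=
  X.Mem × X₁.Mem × X₂.Mem

/-- One step of a player of `Comb(P₁, P₂)` after `P` is over: the player reads its own output of
`P`; on `0` (Alice won) it performs the step `Φ₂` of `P₂`, on `1` (Bob won) the step `Φ₁` of `P₁`,
and on `Abort` it does nothing. -/
def branch (X : Player M) (X₁ : Player M₁) (X₂ : Player M₂)
    (Φ₁ : Channel (X₁.Mem × M₁)) (Φ₂ : Channel (X₂.Mem × M₂)) :
    Channel (CombMem X X₁ X₂ × (M × M₁ × M₂)) :=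
  Channel.measureThen (fun s => X.out s.1.1) fun
    | Outcome.zero => Φ₂.onPart (part₂ X.Mem X₁.Mem X₂.Mem M M₁ M₂)
    | Outcome.one => Φ₁.onPart (part₁ X.Mem X₁.Mem X₂.Mem M M₁ M₂)
    | Outcome.abort => Channel.id _

/-- The player of `Comb(P₁, P₂)` made of a player of each of `P`, `P₁`, `P₂`, acting by `op`. -/
def combPlayer (X : Player M) (X₁ : Player M₁) (X₂ : Player M₂)
    (op : ℕ → Channel (CombMem X X₁ X₂ × (M × M₁ × M₂))) : Player (M × M₁ × M₂) where
  Mem := CombMem X X₁ X₂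
  init := X.init ⊗ₖ (X₁.init ⊗ₖ X₂.init)
  init_isDensity := X.init_isDensity.kronecker (X₁.init_isDensity.kronecker X₂.init_isDensity)
  op := op
  out s := match X.out s.1 with
    | Outcome.zero => X₂.out s.2.2
    | Outcome.one => X₁.out s.2.1
    | Outcome.abort => Outcome.abort

end Comb

/-- The operation that Alice applies at step `i` of `P`; nothing once `P` is over. -/
def aliceStep (P : Protocol) (i : ℕ) : Channel (P.alice.Mem × P.Msg) :=
  if i ≤ P.rounds then P.alice.op i else Channel.id _

/-- The operation that Bob applies at step `i` of `P`; nothing once `P` is over. -/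
def bobStep (P : Protocol) (i : ℕ) : Channel (P.bob.Mem × P.Msg) :=
  if i < P.rounds then P.bob.op i else Channel.id _

/-- Alice's step `i` in `Comb(P₁, P₂)`.  At step `P.rounds` she finishes `P`, prepares blank
message registers for `P₁` and `P₂`, and starts the protocol selected by her output of `P`. -/
def combAliceOp (P P₁ P₂ : Protocol) (i : ℕ) :
    Channel (CombMem P.alice P₁.alice P₂.alice × (P.Msg × P₁.Msg × P₂.Msg)) :=
  if i < P.rounds then
    (P.aliceStep i).onPart (part₀ P.alice.Mem P₁.alice.Mem P₂.alice.Mem P.Msg P₁.Msg P₂.Msg)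
  else if i = P.rounds then
    (((P.aliceStep i).onPart
      (part₀ P.alice.Mem P₁.alice.Mem P₂.alice.Mem P.Msg P₁.Msg P₂.Msg)).andThen
      ((Channel.reset (P₁.blank, P₂.blank)).onPart
        (partMsgs P.alice.Mem P₁.alice.Mem P₂.alice.Mem P.Msg P₁.Msg P₂.Msg))).andThen
      (branch P.alice P₁.alice P₂.alice (P₁.aliceStep 0) (P₂.aliceStep 0))
  else
    branch P.alice P₁.alice P₂.alice (P₁.aliceStep (i - P.rounds)) (P₂.aliceStep (i - P.rounds))

/-- Bob's step `i` in `Comb(P₁, P₂)`. -/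
def combBobOp (P P₁ P₂ : Protocol) (i : ℕ) :
    Channel (CombMem P.bob P₁.bob P₂.bob × (P.Msg × P₁.Msg × P₂.Msg)) :=
  if i < P.rounds then
    (P.bobStep i).onPart (part₀ P.bob.Mem P₁.bob.Mem P₂.bob.Mem P.Msg P₁.Msg P₂.Msg)
  else
    branch P.bob P₁.bob P₂.bob (P₁.bobStep (i - P.rounds)) (P₂.bobStep (i - P.rounds))

/-- `Comb(P₁, P₂)`, by means of `P`: Alice and Bob run `P`; if Alice wins they run `P₂`, if Bob
wins they run `P₁`, and if `P` aborts they abort.  Each player goes by its own output of `P`.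
Players use three message registers side by side, of which an honest player leaves untouched those
that are not in use. -/
def comb (P P₁ P₂ : Protocol) : Protocol where
  Msg := P.Msg × P₁.Msg × P₂.Msg
  blank := (P.blank, P₁.blank, P₂.blank)
  rounds := P.rounds + max P₁.rounds P₂.rounds
  alice := combPlayer P.alice P₁.alice P₂.alice (combAliceOp P P₁ P₂)
  bob := combPlayer P.bob P₁.bob P₂.bob (combBobOp P P₁ P₂)

/-- `CombOf P Q`: the protocol `Q` is obtained from the two trivial protocols (Alice always wins,
Bob always wins) by finitely many applications of `Comb`, by means of `P`. -/
inductive CombOf (P : Protocol) : Protocol → Prop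
  | aliceWins : CombOf P (const Outcome.zero)
  | bobWins : CombOf P (const Outcome.one)
  | comb {P₁ P₂ : Protocol} : CombOf P P₁ → CombOf P P₂ → CombOf P (comb P P₁ P₂)

end Protocol

end CoinFlip

end

set_option linter.unusedSectionVars false
set_option synthInstance.maxSize 1000

noncomputable section

namespace CoinFlip

/-! ### Channels on subsystems: relabelling, nesting, resetting. -/

section Generic

variable {S S' T T' R R' L : Type} [Fintype S] [DecidableEq S] [Fintype S'] [DecidableEq S']
  [Fintype T] [DecidableEq T] [Fintype T'] [DecidableEq T']
  [Fintype R] [DecidableEq R] [Fintype R'] [DecidableEq R'] [Fintype L] [DecidableEq L]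

namespace Channel

/-! Let `P₁`, `P₂` have equal length, honest values x₁ ≤ x₂ and bias e. In `comb P P₁ P₂` a cheating
Alice makes honest Bob output 0 or 1 in `P` with probabilities p₀, p₁, where p₀ ≤ 1/2 + ε and p₀ +
p₁ ≤ 1. Conditioned on that output she wins with probability at most x₂ + e or x₁ + e, so in all
with at most (x₂ - x₁)p₀ + (x₁ + e)(p₀ + p₁) ≤ (x₁ + x₂)/2 + e + ε(x₂ - x₁). Cheating Bob is
symmetric (`comb_isWCF`). The bias thus grows only by ε times the gap x₂ - x₁. Starting from the
values 0 and 1 and always combining neighbouring dyadics, the k-th level has gaps 2^(1-k), so the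
total bias is at most ε(1 + 1/2 + 1/4 + ...) < 2ε when ε > 0 (and 0 when ε = 0), and each level
costs one run of `P` (`exists_combOf_isWCF`). Rounding z down to a multiple of 2^(-k) finishes the
proof.

The quantum content is the conditional bound: a cheater may keep entanglement from `P` into the
second stage. The remedy is `Bounded`, a bound against an opponent with an arbitrary, possibly
entangled and unnormalized, initial state on its memory and the message. For an honest player it
follows from the WCF conditions (`bounded_bob`, `bounded_alice`). The honest memories for `P₁` and
`P₂` are still fresh and independent when `P` ends (`run_part_zero_eq`), so everything else can be
handed to the opponent (`Bounded.subgame`). Conditioning on the honest output of `P` commutes with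
all later steps, and the trace of the conditioned state is the probability of that output
(`weight_run_branch_le`).

For honest players the two winning probabilities are bounded below by a product computation
(`le_probBoth_comb`); the bounds add up to 1, hence are equalities. -/

theorem apply_posSemidef (Φ : Channel S) {ρ : Matrix S S ℂ} (h : ρ.PosSemidef) :
    (Φ.apply ρ).PosSemidef :=
  Matrix.posSemidef_sum _ fun i _ => h.mul_mul_conjTranspose_same (Φ.kraus i)

theorem trace_apply (Φ : Channel S) (ρ : Matrix S S ℂ) : (Φ.apply ρ).trace = ρ.trace := by
  have h : ∀ i, (Φ.kraus i * ρ * (Φ.kraus i)ᴴ).trace = ((Φ.kraus i)ᴴ * Φ.kraus i * ρ).trace := by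
    intro i
    rw [Matrix.trace_mul_comm, Matrix.mul_assoc]
  simp only [apply, Matrix.trace_sum, h]
  rw [← Matrix.trace_sum, ← Finset.sum_mul, Φ.tracePreserving, one_mul]

theorem apply_smul (Φ : Channel S) (c : ℂ) (ρ : Matrix S S ℂ) :
    Φ.apply (c • ρ) = c • Φ.apply ρ := by
  simp [apply, Finset.smul_sum]

theorem apply_zero (Φ : Channel S) : Φ.apply 0 = 0 := by
  simp [apply]

theorem andThen_apply (Φ Ψ : Channel S) (ρ : Matrix S S ℂ) :
    (Φ.andThen Ψ).apply ρ = Ψ.apply (Φ.apply ρ) := by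
  change ∑ p : Φ.Idx × Ψ.Idx, (Ψ.kraus p.2 * Φ.kraus p.1) * ρ * (Ψ.kraus p.2 * Φ.kraus p.1)ᴴ = _
  rw [Fintype.sum_prod_type, Finset.sum_comm]
  simp only [apply, Matrix.conjTranspose_mul]
  simp only [Finset.mul_sum, Finset.sum_mul, Matrix.mul_assoc]

theorem onPart_kraus_apply (e : S ≃ T × R) (Φ : Channel T) (i : Φ.Idx) (a b : S) :
    (Φ.onPart e).kraus i a b =
      Φ.kraus i (e a).1 (e b).1 * if (e a).2 = (e b).2 then 1 else 0 := by
  simp [onPart, Matrix.one_apply]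

/-- A permutation of the basis carries Kraus operators to Kraus operators, and the action of a
channel does not depend on how they are indexed. All relabelling lemmas for `onPart` reduce to this.
-/
theorem apply_submatrix_of_kraus {Φ : Channel S} {Φ' : Channel S'} (f : S' ≃ S)
    (τ : Φ'.Idx ≃ Φ.Idx) (h : ∀ i a b, Φ'.kraus i a b = Φ.kraus (τ i) (f a) (f b))
    (ρ : Matrix S S ℂ) :
    Φ'.apply (ρ.submatrix f f) = (Φ.apply ρ).submatrix f f := by
  have h' : ∀ i, Φ'.kraus i = (Φ.kraus (τ i)).submatrix f f := by
    intro i; ext a b; exact h i a b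
  simp only [apply, h']
  rw [← Equiv.sum_comp τ]
  ext a b
  simp only [Matrix.submatrix_apply, Matrix.sum_apply, Matrix.conjTranspose_submatrix,
    Matrix.submatrix_mul_equiv]

/-- An entry of `K ⊗ 1` sees the spectator labels only through whether they are equal. Hence `h₂`
compares equality patterns, and no map between `R` and `R'` is needed. -/
theorem onPart_apply_submatrix (Φ : Channel T) {f : S' ≃ S} {e : S ≃ T × R} {e' : S' ≃ T × R'}
    (h₁ : ∀ s, (e' s).1 = (e (f s)).1)
    (h₂ : ∀ s t, (e' s).2 = (e' t).2 ↔ (e (f s)).2 = (e (f t)).2) (ρ : Matrix S S ℂ) :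
    (Φ.onPart e').apply (ρ.submatrix f f) = ((Φ.onPart e).apply ρ).submatrix f f := by
  refine apply_submatrix_of_kraus f (Equiv.refl Φ.Idx) (fun (i : Φ.Idx) a b => ?_) ρ
  change (Φ.onPart e').kraus i a b = (Φ.onPart e).kraus i _ _
  simp only [onPart_kraus_apply, h₁, h₂]

theorem onPart_onPart_apply_submatrix (Φ : Channel T) {f : S' ≃ S} {e : S ≃ T' × R}
    {g : T' ≃ T × R'} {e' : S' ≃ T × L}
    (h₁ : ∀ s, (e' s).1 = (g (e (f s)).1).1)
    (h₂ : ∀ s t, (e' s).2 = (e' t).2 ↔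
      (g (e (f s)).1).2 = (g (e (f t)).1).2 ∧ (e (f s)).2 = (e (f t)).2)
    (ρ : Matrix S S ℂ) :
    (Φ.onPart e').apply (ρ.submatrix f f) = (((Φ.onPart g).onPart e).apply ρ).submatrix f f := by
  refine apply_submatrix_of_kraus f (Equiv.refl Φ.Idx) (fun (i : Φ.Idx) a b => ?_) ρ
  change (Φ.onPart e').kraus i a b = ((Φ.onPart g).onPart e).kraus i _ _
  rw [onPart_kraus_apply, onPart_kraus_apply e (Φ.onPart g) i]
  have := onPart_kraus_apply g Φ i
  erw [this]
  simp only [h₁, h₂, mul_assoc, ite_and]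
  split_ifs <;> simp

theorem onPart_onPart_apply (Φ : Channel T) {e : S ≃ T' × R} {g : T' ≃ T × R'} {e' : S ≃ T × L}
    (h₁ : ∀ s, (e' s).1 = (g (e s).1).1)
    (h₂ : ∀ s t, (e' s).2 = (e' t).2 ↔ (g (e s).1).2 = (g (e t).1).2 ∧ (e s).2 = (e t).2)
    (ρ : Matrix S S ℂ) :
    (Φ.onPart e').apply ρ = ((Φ.onPart g).onPart e).apply ρ :=
  onPart_onPart_apply_submatrix (f := Equiv.refl S) Φ h₁ h₂ ρ

theorem onPart_refl_apply_kronecker (Φ : Channel T) (σ : Matrix T T ℂ) (κ : Matrix R R ℂ) :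
    (Φ.onPart (Equiv.refl (T × R))).apply (σ ⊗ₖ κ) = Φ.apply σ ⊗ₖ κ := by
  have h : ∀ i, (Φ.onPart (Equiv.refl (T × R))).kraus i = Φ.kraus i ⊗ₖ (1 : Matrix R R ℂ) := by
    intro i; rfl
  simp only [apply, h]
  change ∑ i : Φ.Idx, _ = _
  simp only [Matrix.conjTranspose_kronecker, ← Matrix.mul_kronecker_mul, Matrix.conjTranspose_one,
    one_mul, mul_one]
  ext a b
  simp [Matrix.sum_apply, Finset.sum_mul]

/-- A channel that acts inside the first factor leaves an independent second factor `κ` as it is;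
this carries the idle systems through a run. -/
theorem onPart_apply_kronecker (Φ : Channel T) {e : S ≃ L × R} {g : L ≃ T × R'}
    {e' : S ≃ T × T'} (h₁ : ∀ s, (e' s).1 = (g (e s).1).1)
    (h₂ : ∀ s t, (e' s).2 = (e' t).2 ↔ (g (e s).1).2 = (g (e t).1).2 ∧ (e s).2 = (e t).2)
    (σ : Matrix L L ℂ) (κ : Matrix R R ℂ) :
    (Φ.onPart e').apply ((σ ⊗ₖ κ).submatrix e e) =
      ((Φ.onPart g).apply σ ⊗ₖ κ).submatrix e e := by
  rw [← onPart_refl_apply_kronecker]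
  exact onPart_onPart_apply_submatrix (e := Equiv.refl _) Φ h₁ h₂ _

theorem onPart_andThen_apply (Φ Ψ : Channel T) (e : S ≃ T × R) (ρ : Matrix S S ℂ) :
    ((Φ.andThen Ψ).onPart e).apply ρ = (Ψ.onPart e).apply ((Φ.onPart e).apply ρ) := by
  rw [← andThen_apply]
  refine apply_submatrix_of_kraus (Φ := (Φ.onPart e).andThen (Ψ.onPart e))
    (Φ' := (Φ.andThen Ψ).onPart e) (Equiv.refl S)
    (Equiv.refl (Φ.Idx × Ψ.Idx)) (fun i a b => ?_) ρ
  obtain ⟨i, j⟩ := i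
  change ((Ψ.kraus j * Φ.kraus i) ⊗ₖ (1 : Matrix R R ℂ)).submatrix e e a b =
    ((Ψ.kraus j ⊗ₖ (1 : Matrix R R ℂ)).submatrix e e *
      (Φ.kraus i ⊗ₖ (1 : Matrix R R ℂ)).submatrix e e) a b
  rw [Matrix.submatrix_mul_equiv, ← Matrix.mul_kronecker_mul, mul_one]

/-- Resetting is a partial trace over the part, followed by a fresh basis state there. -/
theorem reset_onPart_apply (s : T) (e : S ≃ T × R) (ρ : Matrix S S ℂ) (a b : S) :
    ((reset s).onPart e).apply ρ a b =
      if (e a).1 = s ∧ (e b).1 = s then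
        ∑ t, ρ (e.symm (t, (e a).2)) (e.symm (t, (e b).2)) else 0 := by
  have key : ∀ (i : T) (a : S) (f : S → ℂ),
      ∑ c, ((reset s).onPart e).kraus i a c * f c =
        if (e a).1 = s then f (e.symm (i, (e a).2)) else 0 := by
    intro i a f
    have h : ∀ c, ((reset s).onPart e).kraus i a c =
        if c = e.symm (i, (e a).2) then (if (e a).1 = s then 1 else 0) else 0 := by
      intro c
      have := onPart_kraus_apply e (reset s) i a c
      rw [this]
      change Matrix.single s i (1 : ℂ) (e a).1 (e c).1 * _ = _
      rw [Matrix.single_apply]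
      have h' : c = e.symm (i, (e a).2) ↔ (e c).1 = i ∧ (e c).2 = (e a).2 := by
        rw [Equiv.eq_symm_apply, Prod.ext_iff]
      simp only [h', ← ite_and, mul_ite, mul_one, mul_zero]
      congr 1
      simp only [eq_iff_iff]
      exact ⟨fun ⟨h1, h2, h3⟩ => ⟨⟨h3.symm, h1.symm⟩, h2.symm⟩,
        fun ⟨⟨h1, h2⟩, h3⟩ => ⟨h2.symm, h3.symm, h1.symm⟩⟩
    simp [h]
  change (∑ i : T, ((reset s).onPart e).kraus i * ρ * (((reset s).onPart e).kraus i)ᴴ) a b = _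
  rw [Matrix.sum_apply]
  have h2 : ∀ i : T, (((reset s).onPart e).kraus i * ρ * (((reset s).onPart e).kraus i)ᴴ) a b =
      if (e a).1 = s ∧ (e b).1 = s then ρ (e.symm (i, (e a).2)) (e.symm (i, (e b).2)) else 0 := by
    intro i
    -- Conjugating moves the right-hand factor to the left, so that `key` evaluates both sums.
    have h3 : (((reset s).onPart e).kraus i * ρ * (((reset s).onPart e).kraus i)ᴴ) a b =
        ∑ d, star (((reset s).onPart e).kraus i b d * star
          (∑ c, ((reset s).onPart e).kraus i a c * ρ c d)) := by
      simp [Matrix.mul_apply, Matrix.conjTranspose_apply, mul_comm]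
    rw [h3, ← star_sum]
    simp only [key]
    split_ifs <;> simp_all
  simp only [h2]
  split_ifs <;> simp

end Channel

end Generic

/-! ### Outcome probabilities and unnormalized post-measurement states. -/

section Weight

variable {S S' R : Type} [Fintype S] [Fintype S'] [Fintype R]

/-- The probability that a measurement in the computational basis has a result satisfying `p`. -/
def weight (p : S → Prop) [DecidablePred p] (ρ : Matrix S S ℂ) : ℝ :=
  ∑ s, if p s then (ρ s s).re else 0

theorem weight_congr {p q : S → Prop} [DecidablePred p] [DecidablePred q]
    (h : ∀ s, p s ↔ q s) (ρ : Matrix S S ℂ) : weight p ρ = weight q ρ := by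
  simp only [weight, h]

theorem weight_true (ρ : Matrix S S ℂ) : weight (fun _ => True) ρ = ρ.trace.re := by
  simp [weight, Matrix.trace]

theorem weight_smul (p : S → Prop) [DecidablePred p] (c : ℝ) (ρ : Matrix S S ℂ) :
    weight p ((c : ℂ) • ρ) = c * weight p ρ := by
  simp [weight, Finset.mul_sum]

theorem weight_submatrix (p : S → Prop) [DecidablePred p] (f : S' ≃ S) (ρ : Matrix S S ℂ) :
    weight (fun s => p (f s)) (ρ.submatrix f f) = weight p ρ :=
  Equiv.sum_comp f fun s => if p s then (ρ s s).re else 0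

theorem weight_mono {p q : S → Prop} [DecidablePred p] [DecidablePred q]
    (h : ∀ s, p s → q s) {ρ : Matrix S S ℂ} (hρ : ρ.PosSemidef) : weight p ρ ≤ weight q ρ := by
  refine Finset.sum_le_sum fun s _ => ?_
  have h0 : 0 ≤ (ρ s s).re := (Complex.le_def.1 (hρ.diag_nonneg (i := s))).1
  by_cases hp : p s
  · simp [hp, h s hp]
  · by_cases hq : q s <;> simp [hp, hq, h0]

theorem weight_nonneg (p : S → Prop) [DecidablePred p] {ρ : Matrix S S ℂ} (hρ : ρ.PosSemidef) :
    0 ≤ weight p ρ := by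
  have := weight_mono (p := fun _ => False) (q := p) (fun _ h => h.elim) hρ
  simpa [weight] using this

theorem weight_or {p q : S → Prop} [DecidablePred p] [DecidablePred q]
    (h : ∀ s, ¬ (p s ∧ q s)) (ρ : Matrix S S ℂ) :
    weight (fun s => p s ∨ q s) ρ = weight p ρ + weight q ρ := by
  simp only [weight, ← Finset.sum_add_distrib]
  refine Finset.sum_congr rfl fun s _ => ?_
  have := h s
  by_cases hp : p s <;> by_cases hq : q s <;> simp_all

/-- The diagonal of a positive semidefinite `κ` is real, so the real part of a product of diagonal
entries factors. -/
theorem weight_kronecker (p : S → Prop) [DecidablePred p] (ρ : Matrix S S ℂ)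
    {κ : Matrix R R ℂ} (hκ : κ.PosSemidef) :
    weight (fun s : S × R => p s.1) (ρ ⊗ₖ κ) = weight p ρ * κ.trace.re := by
  have h0 : ∀ r, (κ r r).im = 0 := fun r =>
    (Complex.le_def.1 (hκ.diag_nonneg (i := r))).2.symm
  simp only [weight, Fintype.sum_prod_type, Matrix.kroneckerMap_apply, Complex.mul_re, h0,
    mul_zero, sub_zero, Matrix.trace, Matrix.diag_apply, Complex.re_sum, Finset.sum_mul]
  refine Finset.sum_congr rfl fun s _ => ?_
  by_cases hp : p s <;> simp [hp, Finset.mul_sum]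

theorem trace_submatrix_equiv (f : S' ≃ S) (ρ : Matrix S S ℂ) :
    (ρ.submatrix f f).trace = ρ.trace :=
  Equiv.sum_comp f fun s => ρ s s

theorem trace_re_nonneg {σ : Matrix S S ℂ} (h : σ.PosSemidef) : 0 ≤ σ.trace.re :=
  (Complex.le_def.1 h.trace_nonneg).1

/-- The unnormalized state after a measurement with a result satisfying `p`. -/
def restrict (p : S → Prop) [DecidablePred p] (ρ : Matrix S S ℂ) : Matrix S S ℂ :=
  Matrix.of fun a b => if p a ∧ p b then ρ a b else 0

theorem restrict_apply (p : S → Prop) [DecidablePred p] (ρ : Matrix S S ℂ) (a b : S) :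
    restrict p ρ a b = if p a ∧ p b then ρ a b else 0 := rfl

theorem restrict_eq_mul [DecidableEq S] (p : S → Prop) [DecidablePred p] (ρ : Matrix S S ℂ) :
    restrict p ρ = Matrix.diagonal (fun s => if p s then (1 : ℂ) else 0) * ρ *
      Matrix.diagonal (fun s => if p s then (1 : ℂ) else 0) := by
  ext a b
  by_cases ha : p a <;> by_cases hb : p b <;> simp [restrict_apply, ha, hb]

theorem restrict_restrict (p q : S → Prop) [DecidablePred p] [DecidablePred q]
    (ρ : Matrix S S ℂ) : restrict p (restrict q ρ) = restrict (fun s => q s ∧ p s) ρ := by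
  ext a b
  simp only [restrict_apply, ← ite_and]
  congr 1
  simp only [eq_iff_iff]
  tauto

theorem restrict_congr {p q : S → Prop} [DecidablePred p] [DecidablePred q]
    (h : ∀ s, p s ↔ q s) (ρ : Matrix S S ℂ) : restrict p ρ = restrict q ρ := by
  ext a b
  simp only [restrict_apply, h]

theorem restrict_of_forall_not {p : S → Prop} [DecidablePred p] (h : ∀ s, ¬ p s)
    (ρ : Matrix S S ℂ) : restrict p ρ = 0 := by
  ext a b
  simp [restrict_apply, h]

theorem restrict_submatrix (p : S → Prop) [DecidablePred p] (f : S' → S) (ρ : Matrix S S ℂ) :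
    restrict (fun s => p (f s)) (ρ.submatrix f f) = (restrict p ρ).submatrix f f := by
  ext a b
  simp [restrict_apply]

theorem restrict_kronecker (p : S → Prop) [DecidablePred p] (ρ : Matrix S S ℂ)
    (κ : Matrix R R ℂ) :
    restrict (fun s : S × R => p s.1) (ρ ⊗ₖ κ) = restrict p ρ ⊗ₖ κ := by
  ext a b
  simp [restrict_apply]

theorem restrict_sum {ι : Type} (I : Finset ι) (p : S → Prop) [DecidablePred p]
    (ρ : ι → Matrix S S ℂ) : restrict p (∑ i ∈ I, ρ i) = ∑ i ∈ I, restrict p (ρ i) := by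
  ext a b
  simp only [restrict_apply, Matrix.sum_apply]
  split_ifs <;> simp

theorem weight_restrict (p q : S → Prop) [DecidablePred p] [DecidablePred q]
    (ρ : Matrix S S ℂ) : weight p (restrict q ρ) = weight (fun s => q s ∧ p s) ρ := by
  simp only [weight, restrict_apply]
  refine Finset.sum_congr rfl fun s _ => ?_
  by_cases hq : q s <;> by_cases hp : p s <;> simp [hp, hq]

theorem trace_restrict (p : S → Prop) [DecidablePred p] (ρ : Matrix S S ℂ) :
    (restrict p ρ).trace.re = weight p ρ := by
  rw [← weight_true, weight_restrict]
  simp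

end Weight

/-! ### Conditioning, state preparation, and iterated rounds. -/

section Generic

variable {S S' T R : Type} [Fintype S] [DecidableEq S] [Fintype S'] [DecidableEq S']
  [Fintype T] [DecidableEq T] [Fintype R] [DecidableEq R]

theorem restrict_posSemidef (p : S → Prop) [DecidablePred p] {ρ : Matrix S S ℂ}
    (h : ρ.PosSemidef) : (restrict p ρ).PosSemidef := by
  have h2 := h.mul_mul_conjTranspose_same (Matrix.diagonal (fun s => if p s then (1 : ℂ) else 0))
  rw [Matrix.diagonal_conjTranspose] at h2
  have h3 : star (fun s => if p s then (1 : ℂ) else 0) = fun s => if p s then (1 : ℂ) else 0 := by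
    funext s
    by_cases hs : p s <;> simp [hs]
  rwa [h3, ← restrict_eq_mul] at h2

namespace Channel

/-- A diagonal projector that depends only on the spectator commutes with `K ⊗ 1`: conditioning on a
value stored outside the part may come before or after the channel. -/
theorem onPart_apply_restrict (Φ : Channel T) (e : S ≃ T × R) (p : S → Prop) [DecidablePred p]
    (h : ∀ a b, (e a).2 = (e b).2 → (p a ↔ p b)) (ρ : Matrix S S ℂ) :
    (Φ.onPart e).apply (restrict p ρ) = restrict p ((Φ.onPart e).apply ρ) := by
  have hc : ∀ i, (Φ.onPart e).kraus i * Matrix.diagonal (fun s => if p s then (1 : ℂ) else 0) =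
      Matrix.diagonal (fun s => if p s then (1 : ℂ) else 0) * (Φ.onPart e).kraus i := by
    intro i
    ext a b
    rw [Matrix.mul_diagonal, Matrix.diagonal_mul, onPart_kraus_apply e Φ i]
    by_cases hab : (e a).2 = (e b).2
    · simp [hab, h a b hab, mul_comm]
    · simp [hab]
  have hd : (Matrix.diagonal (fun s => if p s then (1 : ℂ) else 0))ᴴ =
      Matrix.diagonal (fun s => if p s then (1 : ℂ) else 0) := by
    rw [Matrix.diagonal_conjTranspose]
    congr 1
    funext s
    by_cases hs : p s <;> simp [hs]
  have hc' : ∀ i, Matrix.diagonal (fun s => if p s then (1 : ℂ) else 0) *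
      ((Φ.onPart e).kraus i)ᴴ =
      ((Φ.onPart e).kraus i)ᴴ * Matrix.diagonal (fun s => if p s then (1 : ℂ) else 0) := by
    intro i
    have := congrArg Matrix.conjTranspose (hc i)
    rwa [Matrix.conjTranspose_mul, Matrix.conjTranspose_mul, hd] at this
  rw [apply, apply, restrict_sum]
  refine Finset.sum_congr rfl fun i _ => ?_
  simp only [restrict_eq_mul]
  rw [← Matrix.mul_assoc, ← Matrix.mul_assoc, hc i, Matrix.mul_assoc _ _ ((Φ.onPart e).kraus i)ᴴ,
    hc' i]
  simp only [Matrix.mul_assoc]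

theorem measureThen_apply {O : Type} [Fintype O] [DecidableEq O] (f : S → O) (Φ : O → Channel S)
    (ρ : Matrix S S ℂ) :
    (measureThen f Φ).apply ρ = ∑ o, (Φ o).apply (restrict (fun s => f s = o) ρ) := by
  change ∑ p : (Σ o : O, (Φ o).Idx),
    ((Φ p.1).kraus p.2 * Matrix.diagonal (fun s => if f s = p.1 then (1 : ℂ) else 0)) * ρ *
    ((Φ p.1).kraus p.2 * Matrix.diagonal (fun s => if f s = p.1 then (1 : ℂ) else 0))ᴴ = _
  rw [Fintype.sum_sigma]
  refine Finset.sum_congr rfl fun o _ => Finset.sum_congr rfl fun i _ => ?_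
  have hd : (Matrix.diagonal (fun s => if f s = o then (1 : ℂ) else 0))ᴴ =
      Matrix.diagonal (fun s => if f s = o then (1 : ℂ) else 0) := by
    rw [Matrix.diagonal_conjTranspose]
    congr 1
    funext s
    by_cases hs : f s = o <;> simp [hs]
  rw [Matrix.conjTranspose_mul, hd]
  simp only [restrict_eq_mul, Matrix.mul_assoc]

/-- On a state supported on `|s⟩`, resetting to `|s⟩` does nothing. -/
theorem reset_onPart_apply_of_supported (t : T) (e : S ≃ T × R) {ρ : Matrix S S ℂ}
    (h : ∀ a b, ρ a b ≠ 0 → (e a).1 = t ∧ (e b).1 = t) :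
    ((reset t).onPart e).apply ρ = ρ := by
  ext a b
  rw [reset_onPart_apply]
  split_ifs with hab
  · rw [Finset.sum_eq_single t]
    · have ha : e.symm (t, (e a).2) = a := by rw [Equiv.symm_apply_eq, ← hab.1]
      have hb : e.symm (t, (e b).2) = b := by rw [Equiv.symm_apply_eq, ← hab.2]
      rw [ha, hb]
    · intro t' _ ht'
      by_contra h0
      exact ht' (by simpa using (h _ _ h0).1)
    · simp
  · by_contra h0
    exact hab (h a b (Ne.symm h0))

theorem reset_onPart_apply_supported (t : T) (e : S ≃ T × R) {ρ : Matrix S S ℂ} (a b : S)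
    (h : ((reset t).onPart e).apply ρ a b ≠ 0) : (e a).1 = t ∧ (e b).1 = t := by
  rw [reset_onPart_apply] at h
  by_contra h0
  exact h (if_neg h0)

/-- Discard the state of the system and replace it by the density matrix `B * Bᴴ`. -/
def prepare (B : Matrix S S ℂ) (hB : (B * Bᴴ).trace = 1) : Channel S where
  Idx := S × S
  kraus p := B * Matrix.single p.1 p.2 1
  tracePreserving := by
    have h : ∀ p : S × S, (B * Matrix.single p.1 p.2 (1 : ℂ))ᴴ * (B * Matrix.single p.1 p.2 1) =
        Matrix.single p.2 p.2 ((Bᴴ * B) p.1 p.1) := by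
      intro p
      rw [Matrix.conjTranspose_mul, Matrix.mul_assoc, ← Matrix.mul_assoc Bᴴ, ← Matrix.mul_assoc]
      simp [Matrix.single_mul_mul_single]
    simp only [h, Fintype.sum_prod_type]
    rw [Finset.sum_comm]
    have h2 : ∀ t : S, ∑ s : S, Matrix.single t t ((Bᴴ * B) s s) =
        Matrix.single t t (1 : ℂ) := by
      intro t
      rw [← hB, Matrix.trace_mul_comm, Matrix.trace]
      exact (map_sum (Matrix.singleAddMonoidHom (α := ℂ) t t) _ _).symm
    simp only [h2]
    ext a b
    rw [Matrix.sum_apply]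
    by_cases hab : a = b
    · subst hab
      simp [Matrix.single_apply]
    · have : ∀ x : S, ¬ (x = a ∧ x = b) := fun x hx => hab (hx.1.symm.trans hx.2)
      simp [hab, this]

theorem prepare_apply (B : Matrix S S ℂ) (hB : (B * Bᴴ).trace = 1) (ρ : Matrix S S ℂ) :
    (prepare B hB).apply ρ = ρ.trace • (B * Bᴴ) := by
  change ∑ p : S × S, (B * Matrix.single p.1 p.2 (1 : ℂ)) * ρ *
    (B * Matrix.single p.1 p.2 (1 : ℂ))ᴴ = _
  have h : ∀ p : S × S, (B * Matrix.single p.1 p.2 (1 : ℂ)) * ρ *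
      (B * Matrix.single p.1 p.2 (1 : ℂ))ᴴ = B * Matrix.single p.1 p.1 (ρ p.2 p.2) * Bᴴ := by
    intro p
    rw [Matrix.conjTranspose_mul, ← Matrix.mul_assoc, Matrix.mul_assoc B, Matrix.mul_assoc B]
    simp [Matrix.single_mul_mul_single]
  simp only [h, ← Finset.sum_mul, ← Finset.mul_sum]
  have h2 : ∑ p : S × S, Matrix.single p.1 p.1 (ρ p.2 p.2) = ρ.trace • (1 : Matrix S S ℂ) := by
    ext a b
    rw [Matrix.sum_apply, Fintype.sum_prod_type]
    by_cases hab : a = b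
    · subst hab
      simp [Matrix.single_apply, Matrix.trace]
    · have : ∀ x : S, ¬ (x = a ∧ x = b) := fun x hx => hab (hx.1.symm.trans hx.2)
      simp [hab, this]
  rw [h2]
  simp

end Channel

open scoped MatrixOrder in
theorem exists_eq_mul_conjTranspose {τ : Matrix S S ℂ} (hτ : τ.PosSemidef) :
    ∃ B : Matrix S S ℂ, τ = B * Bᴴ := by
  have h := CFC.sqrt_mul_sqrt_self τ hτ.nonneg
  have h2 : (CFC.sqrt τ)ᴴ = CFC.sqrt τ :=
    (Matrix.nonneg_iff_posSemidef.1 (CFC.sqrt_nonneg τ)).isHermitian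
  exact ⟨CFC.sqrt τ, by rw [h2, h]⟩

/-- With `τ = B * Bᴴ`, the Kraus operators `B |s⟩⟨t|` produce `τ` from any state. A cheating Alice
uses this to start from any joint state of her memory and the message. -/
theorem exists_prepare {τ : Matrix S S ℂ} (hτ : IsDensity τ) :
    ∃ Φ : Channel S, ∀ ρ : Matrix S S ℂ, ρ.trace = 1 → Φ.apply ρ = τ := by
  obtain ⟨B, hB⟩ := exists_eq_mul_conjTranspose hτ.posSemidef
  refine ⟨Channel.prepare B (by rw [← hB, hτ.trace_eq]), fun ρ hρ => ?_⟩
  rw [Channel.prepare_apply, hρ, one_smul, ← hB]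

/-- The state after `n` rounds, in each of which `F i` and then `G i` is applied. -/
def run (F G : ℕ → Channel S) (ρ : Matrix S S ℂ) : ℕ → Matrix S S ℂ
  | 0 => ρ
  | i + 1 => (G i).apply ((F i).apply (run F G ρ i))

theorem run_posSemidef (F G : ℕ → Channel S) {ρ : Matrix S S ℂ} (h : ρ.PosSemidef) (n : ℕ) :
    (run F G ρ n).PosSemidef := by
  induction n with
  | zero => exact h
  | succ n ih => exact Channel.apply_posSemidef _ (Channel.apply_posSemidef _ ih)

theorem trace_run (F G : ℕ → Channel S) (ρ : Matrix S S ℂ) (n : ℕ) :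
    (run F G ρ n).trace = ρ.trace := by
  induction n with
  | zero => rfl
  | succ n ih => rw [run, Channel.trace_apply, Channel.trace_apply, ih]

/-- `U` is an arbitrary map; below it is a scaling, a relabelling, the adjunction of an idle factor,
or a conditioning. -/
theorem run_intertwine {F G : ℕ → Channel S} {F' G' : ℕ → Channel S'}
    (U : Matrix S S ℂ → Matrix S' S' ℂ) {n : ℕ}
    (hF : ∀ i < n, ∀ ρ, (F' i).apply (U ρ) = U ((F i).apply ρ))
    (hG : ∀ i < n, ∀ ρ, (G' i).apply (U ρ) = U ((G i).apply ρ)) (ρ : Matrix S S ℂ) :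
    run F' G' (U ρ) n = U (run F G ρ n) := by
  induction n with
  | zero => rfl
  | succ n ih =>
    rw [run, run, ih (fun i hi => hF i (by omega)) fun i hi => hG i (by omega),
      hF n (by omega), hG n (by omega)]

theorem run_smul (F G : ℕ → Channel S) (c : ℂ) (ρ : Matrix S S ℂ) (n : ℕ) :
    run F G (c • ρ) n = c • run F G ρ n :=
  run_intertwine (fun ρ => c • ρ) (fun _ _ _ => Channel.apply_smul _ _ _)
    (fun _ _ _ => Channel.apply_smul _ _ _) ρ

theorem IsDensity.submatrix {ρ : Matrix S S ℂ} (h : IsDensity ρ) (f : S' ≃ S) :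
    IsDensity (ρ.submatrix f f) :=
  ⟨h.posSemidef.submatrix f, (trace_submatrix_equiv f ρ).trans h.trace_eq⟩

theorem ket_isDensity (s : S) : IsDensity (ket s) :=
  ⟨by
    have h : ket s = Matrix.diagonal (fun t => if t = s then (1 : ℂ) else 0) := by
      ext a b
      rw [ket, Matrix.single_apply, Matrix.diagonal_apply]
      by_cases hab : a = b
      · subst hab
        simp [eq_comm]
      · have : ¬ (s = a ∧ s = b) := fun hx => hab (hx.1.symm.trans hx.2)
        simp [hab, this]
    rw [h]
    refine Matrix.PosSemidef.diagonal fun t => ?_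
    by_cases ht : t = s <;> simp [ht], by simp [ket]⟩

/-- A positive semidefinite matrix is zero or a positive multiple of a density matrix. -/
theorem eq_zero_or_eq_smul_isDensity {σ : Matrix S S ℂ} (h : σ.PosSemidef) :
    σ = 0 ∨ ∃ τ, IsDensity τ ∧ σ = (σ.trace.re : ℂ) • τ := by
  have ht : σ.trace = (σ.trace.re : ℂ) :=
    Complex.ext rfl (Complex.le_def.1 h.trace_nonneg).2.symm
  by_cases h0 : σ.trace = 0
  · exact Or.inl (h.trace_eq_zero_iff.1 h0)
  · have h1 : ((σ.trace.re : ℝ) : ℂ) ≠ 0 := ht ▸ h0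
    refine Or.inr ⟨(σ.trace.re : ℂ)⁻¹ • σ, ⟨h.smul ?_, ?_⟩, ?_⟩
    · rw [← Complex.ofReal_inv]
      exact Complex.zero_le_real.2 (inv_nonneg.2 (trace_re_nonneg h))
    · rw [Matrix.trace_smul, smul_eq_mul]
      conv_lhs => rw [ht]
      exact inv_mul_cancel₀ h1
    · rw [smul_smul, mul_inv_cancel₀ h1, one_smul]

end Generic

open Player

/-! ### From bounds on cheaters to bounds on opponents with arbitrary initial states. -/

section Bounded

variable {S T R H M E : Type} [Fintype S] [DecidableEq S] [Fintype T] [DecidableEq T]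
  [Fintype R] [DecidableEq R] [Fintype H] [DecidableEq H]
  [Fintype M] [DecidableEq M] [Fintype E] [DecidableEq E]

/-- No signalling: an operation on one part does not change the statistics of the rest. -/
theorem weight_onPart_apply (Φ : Channel T) (e : S ≃ T × R) (p : S → Prop) [DecidablePred p]
    (h : ∀ a b, (e a).2 = (e b).2 → (p a ↔ p b)) (ρ : Matrix S S ℂ) :
    weight p ((Φ.onPart e).apply ρ) = weight p ρ := by
  rw [← trace_restrict, ← Channel.onPart_apply_restrict Φ e p h, Channel.trace_apply,
    trace_restrict]

/-- The interaction of an honest player, who starts in the state `h` and applies `Φ i`, with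
another party who holds the register `M`, starts in the state `σ`, and applies `C i`. -/
def against (h : Matrix H H ℂ) (Φ : ℕ → Channel (H × M)) (C : ℕ → Channel (E × M))
    (σ : Matrix (E × M) (E × M) ℂ) : ℕ → Matrix ((H × M) × E) ((H × M) × E) ℂ :=
  run (fun i => (Φ i).onPart (aliceView H M E)) (fun i => (C i).onPart (bobView H M E))
    ((σ ⊗ₖ h).submatrix (bobView H M E) (bobView H M E))

/-- No party makes the honest player, who starts in the state `h` and applies `Φ 0`, …,
`Φ (m - 1)`, end in a state satisfying `p` with probability greater than `v`. -/
def Bounded (m : ℕ) (h : Matrix H H ℂ) (Φ : ℕ → Channel (H × M)) (p : H → Prop) [DecidablePred p]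
    (v : ℝ) : Prop :=
  ∀ (E : Type) [Fintype E] [DecidableEq E] (C : ℕ → Channel (E × M))
    (σ : Matrix (E × M) (E × M) ℂ), σ.PosSemidef →
    weight (fun s : (H × M) × E => p s.1.1) (against h Φ C σ m) ≤ v * σ.trace.re

/-- Both sides are homogeneous in `σ`. Unnormalized states are allowed in `Bounded` because
conditioning on an output of `P` yields them. -/
theorem bounded_of_isDensity {m : ℕ} {h : Matrix H H ℂ} {Φ : ℕ → Channel (H × M)} {p : H → Prop}
    [DecidablePred p] {v : ℝ}
    (hv : ∀ (E : Type) [Fintype E] [DecidableEq E] (C : ℕ → Channel (E × M))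
      (σ : Matrix (E × M) (E × M) ℂ), IsDensity σ →
      weight (fun s : (H × M) × E => p s.1.1) (against h Φ C σ m) ≤ v) :
    Bounded m h Φ p v := by
  intro E _ _ C σ hσ
  have key : ∀ (c : ℂ) (τ : Matrix (E × M) (E × M) ℂ),
      against h Φ C (c • τ) m = c • against h Φ C τ m := by
    intro c τ
    rw [against, against, Matrix.smul_kronecker, Matrix.submatrix_smul]
    exact run_smul _ _ _ _ _
  rcases eq_zero_or_eq_smul_isDensity hσ with h0 | ⟨τ, hτ, hs⟩
  · have h1 := key 0 σ
    rw [zero_smul, zero_smul] at h1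
    rw [h0, h1]
    simp [weight]
  · have h1 := key σ.trace.re τ
    rw [← hs] at h1
    rw [h1, weight_smul, mul_comm v]
    exact mul_le_mul_of_nonneg_left (hv E C τ hτ) (trace_re_nonneg hσ)

/-- Alice's `op 0` only produces the state that Bob first sees; after it each round is Bob, then
Alice, so the opponent's step `i` is `A.op (i + 1)`. -/
theorem finalState_eq_against_bob (n : ℕ) (blank : M) (A X : Player M) :
    finalState n blank A X = (against X.init X.op (fun i => A.op (i + 1))
      ((A.op 0).apply (A.init ⊗ₖ ket blank)) n).submatrix
        (bobView A.Mem M X.Mem) (bobView A.Mem M X.Mem) := by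
  induction n with
  | zero => exact Channel.onPart_refl_apply_kronecker _ _ _
  | succ n ih =>
    have h1 : finalState (n + 1) blank A X = ((A.op (n + 1)).onPart (aliceView A.Mem M X.Mem)).apply
      (((X.op n).onPart (bobView A.Mem M X.Mem)).apply (finalState n blank A X)) := rfl
    rw [h1, ih, Channel.onPart_apply_submatrix (X.op n) (f := bobView A.Mem M X.Mem)
        (e := aliceView X.Mem M A.Mem)
      (fun _ => rfl) (fun _ _ => Iff.rfl),
      Channel.onPart_apply_submatrix (A.op (n + 1)) (f := bobView A.Mem M X.Mem)
        (e := bobView X.Mem M A.Mem)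
      (fun _ => rfl) (fun _ _ => Iff.rfl)]
    rfl

/-- The party that starts in any state, behaves as `C`, and outputs `c`. -/
def cheater (init : Matrix E E ℂ) (h : IsDensity init) (C : ℕ → Channel (E × M)) (c : Outcome) :
    Player M where
  Mem := E
  init := init
  init_isDensity := h
  op := C
  out _ := c

/-- A cheating Alice acts before Bob does, so her first operation can set up any `σ`, entangled with
the message or not. -/
theorem bounded_bob {n : ℕ} {blank : M} {X : Player M} {c : Outcome} {v : ℝ}
    (hv : ∀ A : Player M, probBoth n blank A X c ≤ v) :
    Bounded n X.init X.op (fun b => X.out b = c) v := by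
  refine bounded_of_isDensity fun E _ _ C σ hσ => ?_
  obtain ⟨Φ, hΦ⟩ := exists_prepare hσ
  -- The cheater needs some initial basis state; a matrix of trace 1 cannot have an empty index
  -- type.
  have hne : Nonempty E := by
    by_contra hE
    rw [not_nonempty_iff] at hE
    have := hσ.trace_eq
    simp [Matrix.trace] at this
  obtain ⟨e₀⟩ := hne
  let A : Player M := cheater (ket e₀) (ket_isDensity e₀)
    (fun i => Nat.casesOn i Φ fun i => C i) c
  refine le_trans (le_of_eq ?_) (hv A)
  have h1 : probBoth n blank A X c =
      weight (fun s => c = c ∧ X.out s.2 = c) (finalState n blank A X) := rfl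
  have h2 : (A.op 0).apply (A.init ⊗ₖ ket blank) = σ :=
    hΦ _ ((ket_isDensity e₀).kronecker (ket_isDensity blank)).trace_eq
  rw [h1, finalState_eq_against_bob, h2]
  simp only [true_and]
  exact (weight_submatrix (fun s : (X.Mem × M) × E => X.out s.1.1 = c) (bobView E M X.Mem) _).symm

/-- The steps `Φ`, the first of which is preceded by blanking the message register. -/
def resetFirst (blank : M) (Φ : ℕ → Channel (H × M)) : ℕ → Channel (H × M)
  | 0 => ((Channel.reset blank).onPart (Equiv.prodComm H M)).andThen (Φ 0)
  | i + 1 => Φ (i + 1)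

/-- The part (message) of the joint system. -/
def msgView (H M E : Type) : (H × M) × E ≃ M × (H × E) where
  toFun s := (s.1.2, (s.1.1, s.2))
  invFun t := ((t.2.1, t.1), t.2.2)
  left_inv _ := rfl
  right_inv _ := rfl

/-- Alice moves first, so the opponent's `σ` would let it tamper with the blank message. Once she
blanks the register herself, only the marginal `τ` of `σ` on `E` survives, and `τ` is a legitimate
initial state for a cheating Bob. She acts `n + 1` times; the opponent's action after her last step
cannot reach her memory. -/
theorem bounded_alice {n : ℕ} {blank : M} {X : Player M} {c : Outcome} {v : ℝ}
    (hv : ∀ B : Player M, probBoth n blank X B c ≤ v) :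
    Bounded (n + 1) X.init (resetFirst blank X.op) (fun a => X.out a = c) v := by
  refine bounded_of_isDensity fun E _ _ C σ hσ => ?_
  let τ : Matrix E E ℂ := ∑ m : M, σ.submatrix (fun e => (e, m)) (fun e => (e, m))
  have hτ : IsDensity τ := by
    refine ⟨Matrix.posSemidef_sum _ fun m _ => hσ.posSemidef.submatrix _, ?_⟩
    rw [← hσ.trace_eq]
    simp only [τ, Matrix.trace, Matrix.diag_apply, Matrix.sum_apply, Matrix.submatrix_apply,
      Fintype.sum_prod_type]
  let B : Player M := cheater τ hτ C c
  have h0 : (((Channel.reset blank).onPart (Equiv.prodComm X.Mem M)).onPart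
      (aliceView X.Mem M E)).apply
        ((σ ⊗ₖ X.init).submatrix (bobView X.Mem M E) (bobView X.Mem M E)) =
      (X.init ⊗ₖ ket blank) ⊗ₖ τ := by
    rw [← Channel.onPart_onPart_apply (Channel.reset blank) (e' := msgView X.Mem M E)
      (fun _ => rfl) (fun s t => by simp [msgView, aliceView, Prod.ext_iff])]
    ext a b
    rw [Channel.reset_onPart_apply]
    simp only [msgView, bobView, ket, τ, Equiv.coe_fn_mk, Equiv.coe_fn_symm_mk,
      Matrix.kroneckerMap_apply, Matrix.submatrix_apply, Matrix.sum_apply, Matrix.single_apply,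
      ← Finset.sum_mul]
    simp only [eq_comm (a := blank)]
    split_ifs <;> ring
  have h1 : ∀ i, (((resetFirst blank X.op) i).onPart (aliceView X.Mem M E)).apply
      (against X.init (resetFirst blank X.op) C σ i) = finalState i blank X B := by
    intro i
    induction i with
    | zero =>
      change ((((Channel.reset blank).onPart (Equiv.prodComm X.Mem M)).andThen (X.op 0)).onPart
        (aliceView X.Mem M E)).apply _ = _
      rw [Channel.onPart_andThen_apply]
      change ((X.op 0).onPart _).apply ((((Channel.reset blank).onPart _).onPart _).apply
        ((σ ⊗ₖ X.init).submatrix (bobView X.Mem M E) (bobView X.Mem M E))) = _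
      rw [h0]
      rfl
    | succ i ih =>
      change ((X.op (i + 1)).onPart _).apply (((C i).onPart (bobView X.Mem M E)).apply
        (((resetFirst blank X.op i).onPart _).apply (against _ _ C σ i))) = _
      rw [ih]
      rfl
  refine le_trans (le_of_eq ?_) (hv B)
  have h2 : against X.init (resetFirst blank X.op) C σ (n + 1) =
      ((C n).onPart (bobView X.Mem M E)).apply (finalState n blank X B) := by
    rw [← h1]
    rfl
  have h3 : probBoth n blank X B c =
      weight (fun s => X.out s.1.1 = c ∧ c = c) (finalState n blank X B) := rfl
  rw [h2, h3]
  simp only [and_true]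
  refine weight_onPart_apply (C n) (bobView X.Mem M E) _ (fun a b hab => ?_) _
  have : a.1.1 = b.1.1 := hab
  rw [this]

theorem stateAfter_eq_run (blank : M) (A B : Player M) (n : ℕ) :
    stateAfter blank A B n = run (fun i => (A.op i).onPart (aliceView A.Mem M B.Mem))
      (fun i => (B.op i).onPart (bobView A.Mem M B.Mem))
      ((A.init ⊗ₖ ket blank) ⊗ₖ B.init) n := by
  induction n with
  | zero => rfl
  | succ n ih => rw [stateAfter, ih]; rfl

theorem finalState_isDensity (n : ℕ) (blank : M) (A B : Player M) :
    IsDensity (finalState n blank A B) := by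
  have h := (A.init_isDensity.kronecker (ket_isDensity blank)).kronecker B.init_isDensity
  rw [finalState, stateAfter_eq_run]
  exact ⟨Channel.apply_posSemidef _ (run_posSemidef _ _ h.posSemidef _),
    by rw [Channel.trace_apply, trace_run, h.trace_eq]⟩

theorem probBoth_le_weight_alice (n : ℕ) (blank : M) (X B : Player M) (c : Outcome) :
    probBoth n blank X B c ≤ weight (fun s => X.out s.1.1 = c) (finalState n blank X B) :=
  weight_mono (p := fun s : (X.Mem × M) × B.Mem => X.out s.1.1 = c ∧ B.out s.2 = c)
    (q := fun s => X.out s.1.1 = c) (fun _ hs => hs.1)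
    (finalState_isDensity n blank X B).posSemidef

theorem probBoth_le_weight_bob (n : ℕ) (blank : M) (A X : Player M) (c : Outcome) :
    probBoth n blank A X c ≤ weight (fun s => X.out s.2 = c) (finalState n blank A X) :=
  weight_mono (p := fun s : (A.Mem × M) × X.Mem => A.out s.1.1 = c ∧ X.out s.2 = c)
    (q := fun s => X.out s.2 = c) (fun _ hs => hs.2)
    (finalState_isDensity n blank A X).posSemidef

end Bounded

/-! ### A protocol running inside a larger system. -/

section Subgame

variable {S T T' R R' H RH CH M RM MM E : Type} [Fintype S] [DecidableEq S]
  [Fintype T] [DecidableEq T] [Fintype T'] [DecidableEq T'] [Fintype R] [DecidableEq R]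
  [Fintype R'] [DecidableEq R'] [Fintype H] [DecidableEq H]
  [Fintype RH] [DecidableEq RH] [Fintype CH] [DecidableEq CH] [Fintype M] [DecidableEq M]
  [Fintype RM] [DecidableEq RM] [Fintype MM] [DecidableEq MM] [Fintype E] [DecidableEq E]

/-- The part of the part. -/
def subpart (g : T' ≃ T × R') (e : S ≃ T' × R) : S ≃ T × (R' × R) where
  toFun s := ((g (e s).1).1, ((g (e s).1).2, (e s).2))
  invFun t := e.symm (g.symm (t.1, t.2.1), t.2.2)
  left_inv s := by simp
  right_inv t := by simp

namespace Channel

theorem onPart_onPart_apply_eq (Φ : Channel T) (g : T' ≃ T × R') (e : S ≃ T' × R)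
    (ρ : Matrix S S ℂ) :
    ((Φ.onPart g).onPart e).apply ρ = (Φ.onPart (subpart g e)).apply ρ :=
  (onPart_onPart_apply Φ (fun _ => rfl) (fun _ _ => by simp [subpart]) ρ).symm

theorem id_onPart_apply (e : S ≃ T × R) (ρ : Matrix S S ℂ) :
    ((Channel.id T).onPart e).apply ρ = ρ := by
  have h : ∀ i : Unit, (((Channel.id T).onPart e).kraus i : Matrix S S ℂ) = 1 := by
    intro i
    ext a b
    rw [onPart_kraus_apply e (Channel.id T) i]
    change (1 : Matrix T T ℂ) _ _ * _ = _
    simp only [Matrix.one_apply, ← e.injective.eq_iff (a := a), Prod.ext_iff, ite_and]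
    split_ifs <;> simp
  change ∑ i : Unit, ((Channel.id T).onPart e).kraus i * ρ *
    (((Channel.id T).onPart e).kraus i)ᴴ = ρ
  simp [h]

theorem onPart_onPart_apply_restrict (Φ : Channel T) (g : T' ≃ T × R') (e : S ≃ T' × R)
    (p : S → Prop) [DecidablePred p]
    (h : ∀ a b, (g (e a).1).2 = (g (e b).1).2 → (e a).2 = (e b).2 → (p a ↔ p b))
    (ρ : Matrix S S ℂ) :
    ((Φ.onPart g).onPart e).apply (restrict p ρ) =
      restrict p (((Φ.onPart g).onPart e).apply ρ) := by
  rw [onPart_onPart_apply_eq, onPart_onPart_apply_eq]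
  refine onPart_apply_restrict Φ _ p (fun a b hab => ?_) ρ
  exact h a b (Prod.ext_iff.1 hab).1 (Prod.ext_iff.1 hab).2

theorem measureThen_onPart_apply {O : Type} [Fintype O] [DecidableEq O] (f : T → O)
    (Φ : O → Channel T) (e : S ≃ T × R) (ρ : Matrix S S ℂ) :
    ((measureThen f Φ).onPart e).apply ρ =
      ∑ o, ((Φ o).onPart e).apply (restrict (fun s => f (e s).1 = o) ρ) := by
  rw [← measureThen_apply (fun s => f (e s).1) (fun o => (Φ o).onPart e)]
  refine apply_submatrix_of_kraus (Φ := measureThen (fun s => f (e s).1) fun o => (Φ o).onPart e)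
    (Φ' := (measureThen f Φ).onPart e) (Equiv.refl S)
    (Equiv.refl (Σ o : O, (Φ o).Idx)) (fun i a b => ?_) ρ
  obtain ⟨o, j⟩ := i
  refine (onPart_kraus_apply e (measureThen f Φ) ⟨o, j⟩ a b).trans ?_
  change ((Φ o).kraus j * Matrix.diagonal (fun s => if f s = o then (1 : ℂ) else 0)) _ _ * _ =
    (((Φ o).onPart e).kraus j * Matrix.diagonal (fun s => if f (e s).1 = o then (1 : ℂ) else 0)) a b
  rw [Matrix.mul_diagonal, Matrix.mul_diagonal, onPart_kraus_apply]
  ring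

end Channel

/-- The part (memory, message) of a system whose memory and message register factor. -/
def partOf (eH : CH ≃ H × RH) (eM : MM ≃ M × RM) : CH × MM ≃ (H × M) × (RH × RM) where
  toFun s := (((eH s.1).1, (eM s.2).1), ((eH s.1).2, (eM s.2).2))
  invFun t := (eH.symm (t.1.1, t.2.1), eM.symm (t.1.2, t.2.2))
  left_inv s := by simp
  right_inv t := by simp

/-- What is outside the part (memory, message) is given to the other party. -/
def subView (eH : CH ≃ H × RH) (eM : MM ≃ M × RM) (E : Type) :
    (CH × MM) × E ≃ (H × M) × (E × RM × RH) where
  toFun s := (((eH s.1.1).1, (eM s.1.2).1), (s.2, (eM s.1.2).2, (eH s.1.1).2))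
  invFun t := ((eH.symm (t.1.1, t.2.2.2), eM.symm (t.1.2, t.2.2.1)), t.2.1)
  left_inv s := by simp
  right_inv t := by simp

/-- The systems on which the other party acts. -/
def otherView (eM : MM ≃ M × RM) (E RH : Type) : (E × RM × RH) × M ≃ (E × MM) × RH where
  toFun s := ((s.1.1, eM.symm (s.2, s.1.2.1)), s.1.2.2)
  invFun t := ((t.1.1, (eM t.1.2).2, t.2), (eM t.1.2).1)
  left_inv s := by simp
  right_inv t := by simp

/-- The opponent in the small game is taken to hold `E × RM × RH`: the cheater's memory, the spare
message registers, and the other memories of the honest player. The cheater's actions on `E × MM`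
are then actions on this memory and `M`, and the honest player keeps only the fresh state `h`,
uncorrelated with `σ`. -/
theorem Bounded.subgame {m : ℕ} {h : Matrix H H ℂ} {Φ : ℕ → Channel (H × M)} {p : H → Prop}
    [DecidablePred p] {v : ℝ} (hB : Bounded m h Φ p v) (eH : CH ≃ H × RH) (eM : MM ≃ M × RM)
    (C : ℕ → Channel (E × MM)) {σ : Matrix ((E × RM × RH) × M) ((E × RM × RH) × M) ℂ}
    (hσ : σ.PosSemidef) :
    weight (fun s => p (eH s.1.1).1)
      (run (fun i => ((Φ i).onPart (partOf eH eM)).onPart (aliceView CH MM E))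
        (fun i => (C i).onPart (bobView CH MM E))
        (((σ ⊗ₖ h).submatrix (bobView H M (E × RM × RH)) (bobView H M (E × RM × RH))).submatrix
          (subView eH eM E) (subView eH eM E)) m) ≤ v * σ.trace.re := by
  have h1 := hB (E × RM × RH) (fun i => (C i).onPart (otherView eM E RH)) σ hσ
  rw [run_intertwine (F := fun i => (Φ i).onPart (aliceView H M (E × RM × RH)))
    (G := fun i => ((C i).onPart (otherView eM E RH)).onPart (bobView H M (E × RM × RH)))
    (fun ρ => ρ.submatrix (subView eH eM E) (subView eH eM E))
    (fun i _ ρ => ?_) (fun i _ ρ => ?_)]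
  · rw [← weight_submatrix _ (subView eH eM E)] at h1
    exact h1
  · rw [← Channel.onPart_onPart_apply (Φ i) (e' := subView eH eM E) (fun _ => rfl)
      (fun s t => by simp [subView, aliceView, partOf, Prod.ext_iff]; tauto)]
    exact Channel.onPart_apply_submatrix (Φ i) (fun _ => rfl)
      (fun s t => by simp [subView, aliceView, Prod.ext_iff]) ρ
  · exact Channel.onPart_onPart_apply_submatrix (C i)
      (fun s => by simp [subView, bobView, otherView])
      (fun s t => ⟨fun h => ⟨congrArg (fun x => (eH x).2) h, congrArg (fun x => (eH x).1) h⟩,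
        fun h => eH.injective (Prod.ext h.2 h.1)⟩) ρ

end Subgame

/-! ### Security of `Comb` against a generic opponent. -/

section Comb

open Protocol

variable {S R M M₁ M₂ E : Type} [Fintype S] [DecidableEq S] [Fintype R] [DecidableEq R]
  [Fintype M] [DecidableEq M] [Fintype M₁] [DecidableEq M₁] [Fintype M₂] [DecidableEq M₂]
  [Fintype E] [DecidableEq E]

/-- The second of three factors, apart from the others. -/
def swapFirst (A A₁ A₂ : Type) : A × A₁ × A₂ ≃ A₁ × (A × A₂) where
  toFun s := (s.2.1, (s.1, s.2.2))
  invFun t := (t.2.1, (t.1, t.2.2))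
  left_inv _ := rfl
  right_inv _ := rfl

/-- The third of three factors, apart from the others. -/
def swapSecond (A A₁ A₂ : Type) : A × A₁ × A₂ ≃ A₂ × (A × A₁) where
  toFun s := (s.2.2, (s.1, s.2.1))
  invFun t := (t.2.1, (t.2.2, t.1))
  left_inv _ := rfl
  right_inv _ := rfl

/-- The output of a player of `Comb(P₁, P₂)`. -/
def combOut (X : Player M) (X₁ : Player M₁) (X₂ : Player M₂) (s : CombMem X X₁ X₂) : Outcome :=
  match X.out s.1 with
  | Outcome.zero => X₂.out s.2.2
  | Outcome.one => X₁.out s.2.1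
  | Outcome.abort => Outcome.abort

theorem combOut_eq_iff (X : Player M) (X₁ : Player M₁) (X₂ : Player M₂) {c : Outcome}
    (hc : c ≠ Outcome.abort) (s : CombMem X X₁ X₂) :
    combOut X X₁ X₂ s = c ↔ (X.out s.1 = Outcome.zero ∧ X₂.out s.2.2 = c) ∨
      (X.out s.1 = Outcome.one ∧ X₁.out s.2.1 = c) := by
  unfold combOut
  cases X.out s.1 <;> simp [Ne.symm hc]

/-- No branch touches the memory of `P` or the systems outside the player and the message registers,
and these are all that `q` may depend on. Hence conditioning on `q` commutes with each branch. -/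
theorem restrict_branch_eq_sum (X : Player M) (X₁ : Player M₁) (X₂ : Player M₂)
    (Φ₁ : Channel (X₁.Mem × M₁)) (Φ₂ : Channel (X₂.Mem × M₂))
    (e : S ≃ (CombMem X X₁ X₂ × (M × M₁ × M₂)) × R) (q : S → Prop) [DecidablePred q]
    (hq : ∀ a b, (e a).1.1.1 = (e b).1.1.1 → (e a).2 = (e b).2 → (q a ↔ q b))
    (ρ : Matrix S S ℂ) :
    restrict q (((branch X X₁ X₂ Φ₁ Φ₂).onPart e).apply ρ) =
      ((Φ₂.onPart (part₂ X.Mem X₁.Mem X₂.Mem M M₁ M₂)).onPart e).apply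
        (restrict (fun s => X.out (e s).1.1.1 = Outcome.zero ∧ q s) ρ) +
      (((Φ₁.onPart (part₁ X.Mem X₁.Mem X₂.Mem M M₁ M₂)).onPart e).apply
        (restrict (fun s => X.out (e s).1.1.1 = Outcome.one ∧ q s) ρ) +
      restrict (fun s => X.out (e s).1.1.1 = Outcome.abort ∧ q s) ρ) := by
  rw [branch, Channel.measureThen_onPart_apply, restrict_sum]
  have hu : (Finset.univ : Finset Outcome) = {Outcome.zero, Outcome.one, Outcome.abort} := rfl
  rw [hu, Finset.sum_insert (by simp), Finset.sum_insert (by simp), Finset.sum_singleton]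
  simp only [Channel.id_onPart_apply]
  rw [← Channel.onPart_onPart_apply_restrict, ← Channel.onPart_onPart_apply_restrict,
    restrict_restrict, restrict_restrict, restrict_restrict]
  · intro a b hab
    exact hq a b (congrArg (fun x => x.1.1) hab)
  · intro a b hab
    exact hq a b (congrArg (fun x => x.1.1) hab)

theorem restrict_branch_zero (X : Player M) (X₁ : Player M₁) (X₂ : Player M₂)
    (Φ₁ : Channel (X₁.Mem × M₁)) (Φ₂ : Channel (X₂.Mem × M₂))
    (e : S ≃ (CombMem X X₁ X₂ × (M × M₁ × M₂)) × R) (q : S → Prop) [DecidablePred q]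
    (hq : ∀ a b, (e a).1.1.1 = (e b).1.1.1 → (e a).2 = (e b).2 → (q a ↔ q b))
    (h0 : ∀ s, q s → X.out (e s).1.1.1 = Outcome.zero) (ρ : Matrix S S ℂ) :
    restrict q (((branch X X₁ X₂ Φ₁ Φ₂).onPart e).apply ρ) =
      ((Φ₂.onPart (part₂ X.Mem X₁.Mem X₂.Mem M M₁ M₂)).onPart e).apply (restrict q ρ) := by
  rw [restrict_branch_eq_sum X X₁ X₂ Φ₁ Φ₂ e q hq,
    restrict_congr (q := q) fun s => ⟨fun h => h.2, fun h => ⟨h0 s h, h⟩⟩,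
    restrict_of_forall_not (p := fun s => X.out (e s).1.1.1 = Outcome.one ∧ q s),
    restrict_of_forall_not (p := fun s => X.out (e s).1.1.1 = Outcome.abort ∧ q s),
    Channel.apply_zero, add_zero, add_zero]
  · intro s hs; simp [h0 s hs.2] at hs
  · intro s hs; simp [h0 s hs.2] at hs

theorem restrict_branch_one (X : Player M) (X₁ : Player M₁) (X₂ : Player M₂)
    (Φ₁ : Channel (X₁.Mem × M₁)) (Φ₂ : Channel (X₂.Mem × M₂))
    (e : S ≃ (CombMem X X₁ X₂ × (M × M₁ × M₂)) × R) (q : S → Prop) [DecidablePred q]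
    (hq : ∀ a b, (e a).1.1.1 = (e b).1.1.1 → (e a).2 = (e b).2 → (q a ↔ q b))
    (h1 : ∀ s, q s → X.out (e s).1.1.1 = Outcome.one) (ρ : Matrix S S ℂ) :
    restrict q (((branch X X₁ X₂ Φ₁ Φ₂).onPart e).apply ρ) =
      ((Φ₁.onPart (part₁ X.Mem X₁.Mem X₂.Mem M M₁ M₂)).onPart e).apply (restrict q ρ) := by
  rw [restrict_branch_eq_sum X X₁ X₂ Φ₁ Φ₂ e q hq,
    restrict_congr (p := fun s => X.out (e s).1.1.1 = Outcome.one ∧ q s) (q := q)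
      fun s => ⟨fun h => h.2, fun h => ⟨h1 s h, h⟩⟩,
    restrict_of_forall_not (p := fun s => X.out (e s).1.1.1 = Outcome.zero ∧ q s),
    restrict_of_forall_not (p := fun s => X.out (e s).1.1.1 = Outcome.abort ∧ q s),
    Channel.apply_zero, zero_add, add_zero]
  · intro s hs; simp [h1 s hs.2] at hs
  · intro s hs; simp [h1 s hs.2] at hs

/-- The memories of the second and third protocols, apart from everything else. -/
def idleView (A A₁ A₂ MM E : Type) :
    ((A × A₁ × A₂) × MM) × E ≃ ((A × MM) × E) × (A₁ × A₂) where
  toFun s := (((s.1.1.1, s.1.2), s.2), s.1.1.2)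
  invFun t := (((t.1.1.1, t.2), t.1.1.2), t.1.2)
  left_inv _ := rfl
  right_inv _ := rfl

/-- Once the first protocol is over, the honest player of `Comb` wins with at most the probability
of winning `P₂` or `P₁`, according to its output of the first protocol. -/
theorem weight_run_branch_le (X : Player M) (X₁ : Player M₁) (X₂ : Player M₂)
    (Φ₁ : ℕ → Channel (X₁.Mem × M₁)) (Φ₂ : ℕ → Channel (X₂.Mem × M₂)) {m : ℕ} {c : Outcome}
    (hc : c ≠ Outcome.abort) {v₁ v₂ : ℝ}
    (h₁ : Bounded m X₁.init Φ₁ (fun b => X₁.out b = c) v₁)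
    (h₂ : Bounded m X₂.init Φ₂ (fun b => X₂.out b = c) v₂)
    (C : ℕ → Channel (E × (M × M₁ × M₂)))
    {σ : Matrix ((X.Mem × (M × M₁ × M₂)) × E) ((X.Mem × (M × M₁ × M₂)) × E) ℂ}
    (hσ : σ.PosSemidef)
    {ρ : Matrix ((CombMem X X₁ X₂ × (M × M₁ × M₂)) × E)
      ((CombMem X X₁ X₂ × (M × M₁ × M₂)) × E) ℂ}
    (hρ : ρ = (σ ⊗ₖ (X₁.init ⊗ₖ X₂.init)).submatrix
      (idleView X.Mem X₁.Mem X₂.Mem (M × M₁ × M₂) E)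
      (idleView X.Mem X₁.Mem X₂.Mem (M × M₁ × M₂) E)) :
    weight (fun s => combOut X X₁ X₂ s.1.1 = c)
      (run (fun i => (branch X X₁ X₂ (Φ₁ i) (Φ₂ i)).onPart
          (aliceView (CombMem X X₁ X₂) (M × M₁ × M₂) E))
        (fun i => (C i).onPart (bobView (CombMem X X₁ X₂) (M × M₁ × M₂) E)) ρ m) ≤
      v₂ * weight (fun s => X.out s.1.1.1 = Outcome.zero) ρ +
      v₁ * weight (fun s => X.out s.1.1.1 = Outcome.one) ρ := by
  have hκ : (X₁.init ⊗ₖ X₂.init).trace = 1 :=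
    (X₁.init_isDensity.kronecker X₂.init_isDensity).trace_eq
  have hrestrict : ∀ o : Outcome, restrict (fun s => X.out s.1.1.1 = o) ρ =
      (restrict (fun s => X.out s.1.1 = o) σ ⊗ₖ (X₁.init ⊗ₖ X₂.init)).submatrix
        (idleView X.Mem X₁.Mem X₂.Mem (M × M₁ × M₂) E)
        (idleView X.Mem X₁.Mem X₂.Mem (M × M₁ × M₂) E) := by
    intro o
    rw [hρ, ← restrict_kronecker, ← restrict_submatrix]
    rfl
  have htrace : ∀ o : Outcome, (restrict (fun s => X.out s.1.1 = o) σ).trace.re =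
      weight (fun s => X.out s.1.1.1 = o) ρ := by
    intro o
    rw [← trace_restrict, hrestrict, trace_submatrix_equiv, Matrix.trace_kronecker, hκ, mul_one]
  -- Winning splits into two disjoint events according to the output of `P`; a win after `abort` is
  -- excluded by `hc`.
  rw [weight_congr (p := fun s : (CombMem X X₁ X₂ × (M × M₁ × M₂)) × E =>
    combOut X X₁ X₂ s.1.1 = c) (fun s => combOut_eq_iff X X₁ X₂ hc s.1.1), weight_or (by
    rintro s ⟨⟨h, -⟩, ⟨h', -⟩⟩
    rw [h] at h'
    cases h'), ← weight_restrict, ← weight_restrict, ← htrace, ← htrace]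
  refine add_le_add ?_ ?_
  -- Conditioning on output 0 is moved from the end of the run to its start, where it turns every
  -- `branch` step into the bare step of `P₂`.
  · rw [← run_intertwine (F' := fun i => ((Φ₂ i).onPart
        (partOf (swapSecond X.Mem X₁.Mem X₂.Mem) (swapSecond M M₁ M₂))).onPart
          (aliceView (CombMem X X₁ X₂) (M × M₁ × M₂) E))
      (G' := fun i => (C i).onPart (bobView (CombMem X X₁ X₂) (M × M₁ × M₂) E))
      (fun ρ => restrict (fun s => X.out s.1.1.1 = Outcome.zero) ρ)
      (fun i _ ρ => (restrict_branch_zero X X₁ X₂ (Φ₁ i) (Φ₂ i) _ _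
        (fun a b h _ => iff_of_eq (congrArg (fun x => X.out x = _) h)) (fun _ h => h) ρ).symm)
      (fun i _ ρ => Channel.onPart_apply_restrict _ _ _
        (fun a b h => iff_of_eq (congrArg (fun x => X.out x.1 = _) h)) ρ), hrestrict]
    -- The conditioned state with all but the fresh memory `X₂.init` assigned to the opponent; the
    -- unused memory of `P₁` goes along.
    let τ := (restrict (fun s => X.out s.1.1 = Outcome.zero) σ ⊗ₖ X₁.init).submatrix
      (fun s : (E × (M × M₁) × (X.Mem × X₁.Mem)) × M₂ =>
        (((s.1.2.2.1, (s.1.2.1.1, s.1.2.1.2, s.2)), s.1.1), s.1.2.2.2))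
      (fun s : (E × (M × M₁) × (X.Mem × X₁.Mem)) × M₂ =>
        (((s.1.2.2.1, (s.1.2.1.1, s.1.2.1.2, s.2)), s.1.1), s.1.2.2.2))
    have hτ : τ.PosSemidef :=
      ((restrict_posSemidef _ hσ).kronecker X₁.init_isDensity.posSemidef).submatrix _
    have hsplit : (restrict (fun s => X.out s.1.1 = Outcome.zero) σ ⊗ₖ
        (X₁.init ⊗ₖ X₂.init)).submatrix (idleView X.Mem X₁.Mem X₂.Mem (M × M₁ × M₂) E)
          (idleView X.Mem X₁.Mem X₂.Mem (M × M₁ × M₂) E) =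
        ((τ ⊗ₖ X₂.init).submatrix (bobView X₂.Mem M₂ (E × (M × M₁) × (X.Mem × X₁.Mem)))
          (bobView X₂.Mem M₂ (E × (M × M₁) × (X.Mem × X₁.Mem)))).submatrix
            (subView (swapSecond X.Mem X₁.Mem X₂.Mem) (swapSecond M M₁ M₂) E)
            (subView (swapSecond X.Mem X₁.Mem X₂.Mem) (swapSecond M M₁ M₂) E) := by
      ext a b
      simp only [Matrix.submatrix_apply, Matrix.kroneckerMap_apply, τ, idleView, bobView, subView,
        swapSecond, Equiv.coe_fn_mk]
      ring
    have hτt : (restrict (fun s => X.out s.1.1 = Outcome.zero) σ).trace = τ.trace := by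
      have := congrArg Matrix.trace hsplit
      simpa only [trace_submatrix_equiv, Matrix.trace_kronecker, X₁.init_isDensity.trace_eq,
        X₂.init_isDensity.trace_eq, mul_one] using this
    rw [hτt, hsplit]
    exact h₂.subgame (swapSecond X.Mem X₁.Mem X₂.Mem) (swapSecond M M₁ M₂) C hτ
  · rw [← run_intertwine (F' := fun i => ((Φ₁ i).onPart
        (partOf (swapFirst X.Mem X₁.Mem X₂.Mem) (swapFirst M M₁ M₂))).onPart
          (aliceView (CombMem X X₁ X₂) (M × M₁ × M₂) E))
      (G' := fun i => (C i).onPart (bobView (CombMem X X₁ X₂) (M × M₁ × M₂) E))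
      (fun ρ => restrict (fun s => X.out s.1.1.1 = Outcome.one) ρ)
      (fun i _ ρ => (restrict_branch_one X X₁ X₂ (Φ₁ i) (Φ₂ i) _ _
        (fun a b h _ => iff_of_eq (congrArg (fun x => X.out x = _) h)) (fun _ h => h) ρ).symm)
      (fun i _ ρ => Channel.onPart_apply_restrict _ _ _
        (fun a b h => iff_of_eq (congrArg (fun x => X.out x.1 = _) h)) ρ), hrestrict]
    -- As above with the roles of `P₁` and `P₂` exchanged.
    let τ := (restrict (fun s => X.out s.1.1 = Outcome.one) σ ⊗ₖ X₂.init).submatrix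
      (fun s : (E × (M × M₂) × (X.Mem × X₂.Mem)) × M₁ =>
        (((s.1.2.2.1, (s.1.2.1.1, s.2, s.1.2.1.2)), s.1.1), s.1.2.2.2))
      (fun s : (E × (M × M₂) × (X.Mem × X₂.Mem)) × M₁ =>
        (((s.1.2.2.1, (s.1.2.1.1, s.2, s.1.2.1.2)), s.1.1), s.1.2.2.2))
    have hτ : τ.PosSemidef :=
      ((restrict_posSemidef _ hσ).kronecker X₂.init_isDensity.posSemidef).submatrix _
    have hsplit : (restrict (fun s => X.out s.1.1 = Outcome.one) σ ⊗ₖ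
        (X₁.init ⊗ₖ X₂.init)).submatrix (idleView X.Mem X₁.Mem X₂.Mem (M × M₁ × M₂) E)
          (idleView X.Mem X₁.Mem X₂.Mem (M × M₁ × M₂) E) =
        ((τ ⊗ₖ X₁.init).submatrix (bobView X₁.Mem M₁ (E × (M × M₂) × (X.Mem × X₂.Mem)))
          (bobView X₁.Mem M₁ (E × (M × M₂) × (X.Mem × X₂.Mem)))).submatrix
            (subView (swapFirst X.Mem X₁.Mem X₂.Mem) (swapFirst M M₁ M₂) E)
            (subView (swapFirst X.Mem X₁.Mem X₂.Mem) (swapFirst M M₁ M₂) E) := by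
      ext a b
      simp only [Matrix.submatrix_apply, Matrix.kroneckerMap_apply, τ, idleView, bobView, subView,
        swapFirst, Equiv.coe_fn_mk]
      ring
    have hτt : (restrict (fun s => X.out s.1.1 = Outcome.one) σ).trace = τ.trace := by
      have := congrArg Matrix.trace hsplit
      simpa only [trace_submatrix_equiv, Matrix.trace_kronecker, X₁.init_isDensity.trace_eq,
        X₂.init_isDensity.trace_eq, mul_one] using this
    rw [hτt, hsplit]
    exact h₁.subgame (swapFirst X.Mem X₁.Mem X₂.Mem) (swapFirst M M₁ M₂) C hτ

/-- While the first protocol runs, the memories of the others stay idle. -/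
theorem run_part_zero_eq (X : Player M) (X₁ : Player M₁) (X₂ : Player M₂)
    (Φ : ℕ → Channel (X.Mem × M)) (C : ℕ → Channel (E × (M × M₁ × M₂)))
    {σ : Matrix (E × (M × M₁ × M₂)) (E × (M × M₁ × M₂)) ℂ} (hσ : σ.PosSemidef) (m : ℕ) :
    ∃ σ' : Matrix ((X.Mem × (M × M₁ × M₂)) × E) ((X.Mem × (M × M₁ × M₂)) × E) ℂ,
      σ'.PosSemidef ∧
      against (X.init ⊗ₖ (X₁.init ⊗ₖ X₂.init))
        (fun i => (Φ i).onPart (part₀ X.Mem X₁.Mem X₂.Mem M M₁ M₂)) C σ m =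
        (σ' ⊗ₖ (X₁.init ⊗ₖ X₂.init)).submatrix
          (idleView X.Mem X₁.Mem X₂.Mem (M × M₁ × M₂) E)
          (idleView X.Mem X₁.Mem X₂.Mem (M × M₁ × M₂) E) := by
  let f : (X.Mem × (M × M₁ × M₂)) × E ≃ (X.Mem × M) × ((M₁ × M₂) × E) :=
    { toFun := fun s => ((s.1.1, s.1.2.1), (s.1.2.2, s.2))
      invFun := fun t => ((t.1.1, (t.1.2, t.2.1)), t.2.2)
      left_inv := fun _ => rfl
      right_inv := fun _ => rfl }
  refine ⟨run (fun i => (Φ i).onPart f)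
    (fun i => (C i).onPart (bobView X.Mem (M × M₁ × M₂) E))
    ((σ ⊗ₖ X.init).submatrix (bobView X.Mem (M × M₁ × M₂) E)
      (bobView X.Mem (M × M₁ × M₂) E)) m,
    run_posSemidef _ _ ((hσ.kronecker X.init_isDensity.posSemidef).submatrix _) _, ?_⟩
  have h0 : (σ ⊗ₖ (X.init ⊗ₖ (X₁.init ⊗ₖ X₂.init))).submatrix
      (bobView (CombMem X X₁ X₂) (M × M₁ × M₂) E) (bobView (CombMem X X₁ X₂) (M × M₁ × M₂) E) =
      ((σ ⊗ₖ X.init).submatrix (bobView X.Mem (M × M₁ × M₂) E)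
        (bobView X.Mem (M × M₁ × M₂) E) ⊗ₖ (X₁.init ⊗ₖ X₂.init)).submatrix
          (idleView X.Mem X₁.Mem X₂.Mem (M × M₁ × M₂) E)
          (idleView X.Mem X₁.Mem X₂.Mem (M × M₁ × M₂) E) := by
    ext a b
    simp only [Matrix.submatrix_apply, Matrix.kroneckerMap_apply, idleView, bobView,
      Equiv.coe_fn_mk]
    ring
  rw [against, h0]
  refine run_intertwine (fun ρ => (ρ ⊗ₖ (X₁.init ⊗ₖ X₂.init)).submatrix
      (idleView X.Mem X₁.Mem X₂.Mem (M × M₁ × M₂) E)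
      (idleView X.Mem X₁.Mem X₂.Mem (M × M₁ × M₂) E)) (fun i _ ρ => ?_) (fun i _ ρ => ?_) _
  · rw [← Channel.onPart_onPart_apply (Φ i) (e' :=
      subView (Equiv.refl (CombMem X X₁ X₂)) (Equiv.refl (M × M₁ × M₂)) E) (fun _ => rfl)
      (fun s t => by simp [subView, aliceView, part₀, Prod.ext_iff]; tauto)]
    exact Channel.onPart_apply_kronecker (Φ i) (fun _ => rfl)
      (fun s t => by simp [subView, idleView, f, Prod.ext_iff]; tauto) _ _
  · exact Channel.onPart_apply_kronecker (C i) (fun _ => rfl)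
      (fun s t => by simp [bobView, idleView, Prod.ext_iff]) _ _

/-- During `P` the idle memories and the spare registers count as the opponent's, so `P` is itself a
subgame. -/
theorem weight_run_part_zero_le (X : Player M) (X₁ : Player M₁) (X₂ : Player M₂)
    (Φ : ℕ → Channel (X.Mem × M)) (C : ℕ → Channel (E × (M × M₁ × M₂)))
    {σ : Matrix (E × (M × M₁ × M₂)) (E × (M × M₁ × M₂)) ℂ} (hσ : σ.PosSemidef) {m : ℕ}
    {o : Outcome} {w : ℝ} (hw : Bounded m X.init Φ (fun b => X.out b = o) w) :
    weight (fun s => X.out s.1.1.1 = o) (against (X.init ⊗ₖ (X₁.init ⊗ₖ X₂.init))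
        (fun i => (Φ i).onPart (part₀ X.Mem X₁.Mem X₂.Mem M M₁ M₂)) C σ m) ≤
      w * σ.trace.re := by
  let τ := (σ ⊗ₖ (X₁.init ⊗ₖ X₂.init)).submatrix
      (fun s : (E × (M₁ × M₂) × (X₁.Mem × X₂.Mem)) × M => ((s.1.1, (s.2, s.1.2.1)), s.1.2.2))
      (fun s : (E × (M₁ × M₂) × (X₁.Mem × X₂.Mem)) × M => ((s.1.1, (s.2, s.1.2.1)), s.1.2.2))
  have hτ : τ.PosSemidef := (hσ.kronecker
    (X₁.init_isDensity.posSemidef.kronecker X₂.init_isDensity.posSemidef)).submatrix _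
  have hsplit : (σ ⊗ₖ (X.init ⊗ₖ (X₁.init ⊗ₖ X₂.init))).submatrix
      (bobView (CombMem X X₁ X₂) (M × M₁ × M₂) E) (bobView (CombMem X X₁ X₂) (M × M₁ × M₂) E) =
      ((τ ⊗ₖ X.init).submatrix (bobView X.Mem M (E × (M₁ × M₂) × (X₁.Mem × X₂.Mem)))
        (bobView X.Mem M (E × (M₁ × M₂) × (X₁.Mem × X₂.Mem)))).submatrix
          (subView (Equiv.refl (CombMem X X₁ X₂)) (Equiv.refl (M × M₁ × M₂)) E)
          (subView (Equiv.refl (CombMem X X₁ X₂)) (Equiv.refl (M × M₁ × M₂)) E) := by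
    ext a b
    simp only [Matrix.submatrix_apply, Matrix.kroneckerMap_apply, τ, bobView, subView,
      Equiv.coe_fn_mk, Equiv.refl_apply]
    ring
  have hτt : σ.trace = τ.trace := by
    have := congrArg Matrix.trace hsplit
    simpa only [trace_submatrix_equiv, Matrix.trace_kronecker, X.init_isDensity.trace_eq,
      X₁.init_isDensity.trace_eq, X₂.init_isDensity.trace_eq, mul_one] using this
  rw [hτt, against, hsplit]
  exact hw.subgame (Equiv.refl (CombMem X X₁ X₂)) (Equiv.refl (M × M₁ × M₂)) C hτ

end Comb

open Player Protocol

section Run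

variable {S : Type} [Fintype S] [DecidableEq S]

theorem run_add (F G : ℕ → Channel S) (ρ : Matrix S S ℂ) (m n : ℕ) :
    run F G ρ (m + n) = run (fun i => F (m + i)) (fun i => G (m + i)) (run F G ρ m) n := by
  induction n with
  | zero => rfl
  | succ n ih => rw [← add_assoc, run, ih, run]

theorem run_congr {F F' G G' : ℕ → Channel S} {n : ℕ} (hF : ∀ i < n, F i = F' i)
    (hG : ∀ i < n, G i = G' i) (ρ : Matrix S S ℂ) : run F G ρ n = run F' G' ρ n :=
  run_intertwine (fun ρ => ρ) (fun i hi ρ => by rw [hF i hi]) (fun i hi ρ => by rw [hG i hi]) ρ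

end Run

section Comb

variable {M M₁ M₂ E : Type} [Fintype M] [DecidableEq M] [Fintype M₁] [DecidableEq M₁]
  [Fintype M₂] [DecidableEq M₂] [Fintype E] [DecidableEq E]

/-- `p₀` and `p₁` are the probabilities that the honest player's memory after the first stage reads
0 or 1; being read off one state, they add up to at most 1. They are chosen before `w`, so that the
same pair can be compared with any available bound. The step counts `m` and `n` are left free
because Alice makes one step more than Bob. -/
theorem weight_comb_le (X : Player M) (X₁ : Player M₁) (X₂ : Player M₂)
    (Φ : ℕ → Channel (X.Mem × M)) (Φ₁ : ℕ → Channel (X₁.Mem × M₁))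
    (Φ₂ : ℕ → Channel (X₂.Mem × M₂)) {n : ℕ} (m : ℕ) {c : Outcome} (hc : c ≠ Outcome.abort)
    {v₁ v₂ : ℝ} (h₁ : Bounded n X₁.init Φ₁ (fun b => X₁.out b = c) v₁)
    (h₂ : Bounded n X₂.init Φ₂ (fun b => X₂.out b = c) v₂)
    (C C' : ℕ → Channel (E × (M × M₁ × M₂)))
    {σ : Matrix (E × (M × M₁ × M₂)) (E × (M × M₁ × M₂)) ℂ} (hσ : IsDensity σ) :
    ∃ p₀ p₁ : ℝ, 0 ≤ p₀ ∧ 0 ≤ p₁ ∧ p₀ + p₁ ≤ 1 ∧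
      (∀ w, Bounded m X.init Φ (fun b => X.out b = Outcome.zero) w → p₀ ≤ w) ∧
      (∀ w, Bounded m X.init Φ (fun b => X.out b = Outcome.one) w → p₁ ≤ w) ∧
      weight (fun s => combOut X X₁ X₂ s.1.1 = c)
        (run (fun i => (branch X X₁ X₂ (Φ₁ i) (Φ₂ i)).onPart
            (aliceView (CombMem X X₁ X₂) (M × M₁ × M₂) E))
          (fun i => (C' i).onPart (bobView (CombMem X X₁ X₂) (M × M₁ × M₂) E))
          (against (X.init ⊗ₖ (X₁.init ⊗ₖ X₂.init))
            (fun i => (Φ i).onPart (part₀ X.Mem X₁.Mem X₂.Mem M M₁ M₂)) C σ m) n) ≤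
        v₂ * p₀ + v₁ * p₁ := by
  obtain ⟨σ', hσ', hρ⟩ := run_part_zero_eq X X₁ X₂ Φ C hσ.posSemidef m
  have hpos : (against (X.init ⊗ₖ (X₁.init ⊗ₖ X₂.init))
      (fun i => (Φ i).onPart (part₀ X.Mem X₁.Mem X₂.Mem M M₁ M₂)) C σ m).PosSemidef := by
    rw [hρ]
    exact (hσ'.kronecker
      (X₁.init_isDensity.posSemidef.kronecker X₂.init_isDensity.posSemidef)).submatrix _
  refine ⟨_, _, weight_nonneg _ hpos, weight_nonneg _ hpos, ?_, fun w hw => ?_, fun w hw => ?_,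
    weight_run_branch_le X X₁ X₂ Φ₁ Φ₂ hc h₁ h₂ C' hσ' hρ⟩
  · rw [← weight_or fun s h => by rw [h.1] at h; cases h.2]
    refine (weight_mono (q := fun _ => True) (fun _ _ => trivial) hpos).trans_eq ?_
    rw [weight_true, against, trace_run, trace_submatrix_equiv, Matrix.trace_kronecker,
      (X.init_isDensity.kronecker (X₁.init_isDensity.kronecker X₂.init_isDensity)).trace_eq,
      hσ.trace_eq]
    simp
  · simpa [hσ.trace_eq] using weight_run_part_zero_le X X₁ X₂ Φ C hσ.posSemidef hw
  · simpa [hσ.trace_eq] using weight_run_part_zero_le X X₁ X₂ Φ C hσ.posSemidef hw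

end Comb

/-- With `P₁` and `P₂` of equal length, Bob's steps in `Comb` are the genuine ones of `P`, then of
the selected protocol, with no padding by the identity. The cheater's own output is dropped: honest
Bob's output alone bounds the win. -/
theorem probBoth_comb_bob_le (P P₁ P₂ : Protocol) {n : ℕ} (hn₁ : P₁.rounds = n)
    (hn₂ : P₂.rounds = n) {c : Outcome} (hc : c ≠ Outcome.abort) {v₁ v₂ : ℝ}
    (h₁ : ∀ A, probBoth P₁.rounds P₁.blank A P₁.bob c ≤ v₁)
    (h₂ : ∀ A, probBoth P₂.rounds P₂.blank A P₂.bob c ≤ v₂) (A : Player (comb P P₁ P₂).Msg) :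
    ∃ p₀ p₁ : ℝ, 0 ≤ p₀ ∧ 0 ≤ p₁ ∧ p₀ + p₁ ≤ 1 ∧
      (∀ w, (∀ A, probBoth P.rounds P.blank A P.bob Outcome.zero ≤ w) → p₀ ≤ w) ∧
      (∀ w, (∀ A, probBoth P.rounds P.blank A P.bob Outcome.one ≤ w) → p₁ ≤ w) ∧
      probBoth (comb P P₁ P₂).rounds (comb P P₁ P₂).blank A (comb P P₁ P₂).bob c ≤
        v₂ * p₀ + v₁ * p₁ := by
  rw [hn₁] at h₁
  rw [hn₂] at h₂
  have hr : (comb P P₁ P₂).rounds = P.rounds + n := by simp [comb, hn₁, hn₂]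
  have hσ : IsDensity ((A.op 0).apply (A.init ⊗ₖ ket (comb P P₁ P₂).blank)) :=
    have h := A.init_isDensity.kronecker (ket_isDensity (comb P P₁ P₂).blank)
    ⟨Channel.apply_posSemidef _ h.posSemidef, by rw [Channel.trace_apply, h.trace_eq]⟩
  obtain ⟨p₀, p₁, h0, h1, h01, hw0, hw1, hle⟩ := weight_comb_le P.bob P₁.bob P₂.bob P.bob.op
    P₁.bob.op P₂.bob.op P.rounds hc (bounded_bob h₁) (bounded_bob h₂) (fun i => A.op (i + 1))
    (fun i => A.op (P.rounds + i + 1)) hσ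
  refine ⟨p₀, p₁, h0, h1, h01, fun w hw => hw0 w (bounded_bob hw),
    fun w hw => hw1 w (bounded_bob hw), ?_⟩
  refine (probBoth_le_weight_bob _ _ _ _ _).trans (le_trans (le_of_eq ?_) hle)
  rw [finalState_eq_against_bob, hr]
  refine (weight_submatrix (fun s : ((comb P P₁ P₂).bob.Mem × (comb P P₁ P₂).Msg) × A.Mem =>
    (comb P P₁ P₂).bob.out s.1.1 = c) (bobView A.Mem (comb P P₁ P₂).Msg (comb P P₁ P₂).bob.Mem)
    _).trans ?_
  rw [against, run_add]
  have e1 : ∀ i < P.rounds, combBobOp P P₁ P₂ i = (P.bob.op i).onPart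
      (part₀ P.bob.Mem P₁.bob.Mem P₂.bob.Mem P.Msg P₁.Msg P₂.Msg) := by
    intro i hi
    simp only [combBobOp, bobStep, if_pos hi]
  have e2 : ∀ i < n, combBobOp P P₁ P₂ (P.rounds + i) =
      branch P.bob P₁.bob P₂.bob (P₁.bob.op i) (P₂.bob.op i) := by
    intro i hi
    rw [combBobOp, if_neg (by omega), Nat.add_sub_cancel_left, bobStep, bobStep,
      if_pos (by omega), if_pos (by omega)]
  congr 1
  refine (run_congr (fun i hi => congrArg (Channel.onPart _) (e2 i hi)) (fun i _ => rfl) _).trans ?_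
  congr 1
  exact run_congr (fun i hi => congrArg (Channel.onPart _) (e1 i hi)) (fun i _ => rfl) _

/-! ### Honest Alice in `Comb`: the handover between the two stages. -/

section Alice

variable (P P₁ P₂ : Protocol)

/-- The memory of honest Alice in `Comb(P₁, P₂)`. -/
abbrev AliceMem : Type := CombMem P.alice P₁.alice P₂.alice

/-- The message register of `Comb(P₁, P₂)`. -/
abbrev CombMsg : Type := P.Msg × P₁.Msg × P₂.Msg

/-- The joint state of `Comb(P₁, P₂)` after `r` rounds, when Alice is honest. -/
def combState (B : Player (CombMsg P P₁ P₂)) :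
    ℕ → Matrix ((AliceMem P P₁ P₂ × CombMsg P P₁ P₂) × B.Mem)
      ((AliceMem P P₁ P₂ × CombMsg P P₁ P₂) × B.Mem) ℂ :=
  run (fun i => (combAliceOp P P₁ P₂ i).onPart
      (aliceView (AliceMem P P₁ P₂) (CombMsg P P₁ P₂) B.Mem))
    (fun i => (B.op i).onPart (bobView (AliceMem P P₁ P₂) (CombMsg P P₁ P₂) B.Mem))
    (((P.alice.init ⊗ₖ (P₁.alice.init ⊗ₖ P₂.alice.init)) ⊗ₖ
      ket (P.blank, P₁.blank, P₂.blank)) ⊗ₖ B.init)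

/-- The joint state of `Comb(P₁, P₂)` after `r` rounds and a further step of honest Alice. -/
def combFinal (B : Player (CombMsg P P₁ P₂)) (r : ℕ) :
    Matrix ((AliceMem P P₁ P₂ × CombMsg P P₁ P₂) × B.Mem)
      ((AliceMem P P₁ P₂ × CombMsg P P₁ P₂) × B.Mem) ℂ :=
  ((combAliceOp P P₁ P₂ r).onPart
    (aliceView (AliceMem P P₁ P₂) (CombMsg P P₁ P₂) B.Mem)).apply (combState P P₁ P₂ B r)

/-- The joint state when honest Alice has finished `P` and has prepared blank message registers. -/
def afterFirst (B : Player (CombMsg P P₁ P₂)) :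
    Matrix ((AliceMem P P₁ P₂ × CombMsg P P₁ P₂) × B.Mem)
      ((AliceMem P P₁ P₂ × CombMsg P P₁ P₂) × B.Mem) ℂ :=
  (((Channel.reset (P₁.blank, P₂.blank)).onPart
      (partMsgs P.alice.Mem P₁.alice.Mem P₂.alice.Mem P.Msg P₁.Msg P₂.Msg)).onPart
        (aliceView (AliceMem P P₁ P₂) (CombMsg P P₁ P₂) B.Mem)).apply
    ((((P.alice.op P.rounds).onPart
      (part₀ P.alice.Mem P₁.alice.Mem P₂.alice.Mem P.Msg P₁.Msg P₂.Msg)).onPart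
        (aliceView (AliceMem P P₁ P₂) (CombMsg P P₁ P₂) B.Mem)).apply
      (combState P P₁ P₂ B P.rounds))

variable {P P₁ P₂}

theorem combFinal_eq_finalState (B : Player (CombMsg P P₁ P₂)) (r : ℕ) :
    finalState r (comb P P₁ P₂).blank (comb P P₁ P₂).alice B = combFinal P P₁ P₂ B r :=
  congrArg ((combAliceOp P P₁ P₂ r).onPart
    (aliceView (AliceMem P P₁ P₂) (CombMsg P P₁ P₂) B.Mem)).apply
    (stateAfter_eq_run (comb P P₁ P₂).blank (comb P P₁ P₂).alice B r)

theorem combState_succ (B : Player (CombMsg P P₁ P₂)) (r : ℕ) :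
    combState P P₁ P₂ B (r + 1) =
      ((B.op r).onPart (bobView (AliceMem P P₁ P₂) (CombMsg P P₁ P₂) B.Mem)).apply
        (combFinal P P₁ P₂ B r) := rfl

theorem combAliceOp_of_lt {i : ℕ} (hi : i < P.rounds) :
    combAliceOp P P₁ P₂ i = (P.alice.op i).onPart
      (part₀ P.alice.Mem P₁.alice.Mem P₂.alice.Mem P.Msg P₁.Msg P₂.Msg) := by
  simp only [combAliceOp, aliceStep, if_pos hi, if_pos hi.le]

/-- Alice's step number `P.rounds` finishes `P`, blanks the registers and makes the first move of
the next protocol. Its first two thirds are absorbed into `afterFirst`, after which her steps are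
plain branches. -/
theorem combFinal_add {n : ℕ} (hn₁ : P₁.rounds = n) (hn₂ : P₂.rounds = n)
    (B : Player (CombMsg P P₁ P₂)) {j : ℕ} (hj : j ≤ n) :
    combFinal P P₁ P₂ B (P.rounds + j) =
      ((branch P.alice P₁.alice P₂.alice (P₁.alice.op j) (P₂.alice.op j)).onPart
        (aliceView (AliceMem P P₁ P₂) (CombMsg P P₁ P₂) B.Mem)).apply
      (run (fun i => (branch P.alice P₁.alice P₂.alice (P₁.alice.op i) (P₂.alice.op i)).onPart
          (aliceView (AliceMem P P₁ P₂) (CombMsg P P₁ P₂) B.Mem))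
        (fun i => (B.op (P.rounds + i)).onPart
          (bobView (AliceMem P P₁ P₂) (CombMsg P P₁ P₂) B.Mem)) (afterFirst P P₁ P₂ B) j) := by
  induction j with
  | zero =>
    have h : combAliceOp P P₁ P₂ P.rounds =
        (((P.alice.op P.rounds).onPart
          (part₀ P.alice.Mem P₁.alice.Mem P₂.alice.Mem P.Msg P₁.Msg P₂.Msg)).andThen
          ((Channel.reset (P₁.blank, P₂.blank)).onPart
            (partMsgs P.alice.Mem P₁.alice.Mem P₂.alice.Mem P.Msg P₁.Msg P₂.Msg))).andThen
          (branch P.alice P₁.alice P₂.alice (P₁.alice.op 0) (P₂.alice.op 0)) := by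
      simp only [combAliceOp, aliceStep, lt_irrefl, if_false, if_true, le_refl, Nat.zero_le]
    rw [combFinal, add_zero, h, Channel.onPart_andThen_apply, Channel.onPart_andThen_apply]
    rfl
  | succ j ih =>
    have h : combAliceOp P P₁ P₂ (P.rounds + (j + 1)) =
        branch P.alice P₁.alice P₂.alice (P₁.alice.op (j + 1)) (P₂.alice.op (j + 1)) := by
      rw [combAliceOp, if_neg (by omega), if_neg (by omega), Nat.add_sub_cancel_left, aliceStep,
        aliceStep, if_pos (by omega), if_pos (by omega)]
    rw [combFinal, h, ← add_assoc, combState_succ, ih (by omega)]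
    rfl

/-- `bounded_alice` speaks of an Alice who blanks the register at her first step. On states whose
registers are already blank that extra reset does nothing, so her actual steps give the same state.
-/
theorem branch_reset_apply {S R M M₁ M₂ : Type} [Fintype S] [DecidableEq S] [Fintype R]
    [DecidableEq R] [Fintype M] [DecidableEq M] [Fintype M₁] [DecidableEq M₁] [Fintype M₂]
    [DecidableEq M₂] (X : Player M) (X₁ : Player M₁) (X₂ : Player M₂)
    (Φ₁ : Channel (X₁.Mem × M₁)) (Φ₂ : Channel (X₂.Mem × M₂)) (b₁ : M₁) (b₂ : M₂)
    (e : S ≃ (CombMem X X₁ X₂ × (M × M₁ × M₂)) × R) {ρ : Matrix S S ℂ}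
    (hρ : ∀ a b, ρ a b ≠ 0 → (e a).1.2.2 = (b₁, b₂) ∧ (e b).1.2.2 = (b₁, b₂)) :
    ((branch X X₁ X₂ (((Channel.reset b₁).onPart (Equiv.prodComm X₁.Mem M₁)).andThen Φ₁)
        (((Channel.reset b₂).onPart (Equiv.prodComm X₂.Mem M₂)).andThen Φ₂)).onPart e).apply ρ =
      ((branch X X₁ X₂ Φ₁ Φ₂).onPart e).apply ρ := by
  have hr : ∀ (p : S → Prop) [DecidablePred p], ∀ a b, restrict p ρ a b ≠ 0 →
      (e a).1.2.2 = (b₁, b₂) ∧ (e b).1.2.2 = (b₁, b₂) := by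
    intro p _ a b h
    rw [restrict_apply] at h
    exact hρ a b fun h0 => h (by simp [h0])
  rw [branch, branch, Channel.measureThen_onPart_apply, Channel.measureThen_onPart_apply]
  refine Finset.sum_congr rfl fun o _ => ?_
  cases o with
  | zero =>
    change (((((Channel.reset b₂).onPart (Equiv.prodComm X₂.Mem M₂)).andThen Φ₂).onPart _).onPart
      e).apply _ = ((Φ₂.onPart _).onPart e).apply _
    rw [Channel.onPart_onPart_apply_eq, Channel.onPart_onPart_apply_eq,
      Channel.onPart_andThen_apply, Channel.onPart_onPart_apply_eq (Channel.reset b₂),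
      Channel.reset_onPart_apply_of_supported]
    intro a b h
    have := hr _ a b h
    exact ⟨congrArg Prod.snd this.1, congrArg Prod.snd this.2⟩
  | one =>
    change (((((Channel.reset b₁).onPart (Equiv.prodComm X₁.Mem M₁)).andThen Φ₁).onPart _).onPart
      e).apply _ = ((Φ₁.onPart _).onPart e).apply _
    rw [Channel.onPart_onPart_apply_eq, Channel.onPart_onPart_apply_eq,
      Channel.onPart_andThen_apply, Channel.onPart_onPart_apply_eq (Channel.reset b₁),
      Channel.reset_onPart_apply_of_supported]
    intro a b h
    have := hr _ a b h
    exact ⟨congrArg Prod.fst this.1, congrArg Prod.fst this.2⟩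
  | abort => rfl

theorem afterFirst_supported (B : Player (CombMsg P P₁ P₂))
    (a b : (AliceMem P P₁ P₂ × CombMsg P P₁ P₂) × B.Mem) (h : afterFirst P P₁ P₂ B a b ≠ 0) :
    a.1.2.2 = (P₁.blank, P₂.blank) ∧ b.1.2.2 = (P₁.blank, P₂.blank) := by
  rw [afterFirst, Channel.onPart_onPart_apply_eq (Channel.reset _)] at h
  exact Channel.reset_onPart_apply_supported _ _ a b h

/-- The message registers of the second and third protocols, apart from everything else. -/
def otherMsgs (E M M₁ M₂ : Type) : E × (M × M₁ × M₂) ≃ (M₁ × M₂) × (E × M) where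
  toFun s := (s.2.2, (s.1, s.2.1))
  invFun t := (t.2.1, (t.2.2, t.1))
  left_inv _ := rfl
  right_inv _ := rfl

/-- A cheating Bob may be taken to prepare the blank registers in place of Alice. -/
theorem afterFirst_eq_against (B : Player (CombMsg P P₁ P₂)) :
    afterFirst P P₁ P₂ B = against (P.alice.init ⊗ₖ (P₁.alice.init ⊗ₖ P₂.alice.init))
      (fun i => (resetFirst P.blank P.alice.op i).onPart
        (part₀ P.alice.Mem P₁.alice.Mem P₂.alice.Mem P.Msg P₁.Msg P₂.Msg))
      (fun i => if i < P.rounds then B.op i else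
        (Channel.reset (P₁.blank, P₂.blank)).onPart (otherMsgs B.Mem P.Msg P₁.Msg P₂.Msg))
      (B.init ⊗ₖ ket (P.blank, P₁.blank, P₂.blank)) (P.rounds + 1) := by
  set C : ℕ → Channel (B.Mem × CombMsg P P₁ P₂) := fun i => if i < P.rounds then B.op i else
    (Channel.reset (P₁.blank, P₂.blank)).onPart (otherMsgs B.Mem P.Msg P₁.Msg P₂.Msg) with hC
  have key : ∀ i ≤ P.rounds, (((resetFirst P.blank P.alice.op i).onPart
      (part₀ P.alice.Mem P₁.alice.Mem P₂.alice.Mem P.Msg P₁.Msg P₂.Msg)).onPart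
        (aliceView (AliceMem P P₁ P₂) (CombMsg P P₁ P₂) B.Mem)).apply
      (against (P.alice.init ⊗ₖ (P₁.alice.init ⊗ₖ P₂.alice.init))
        (fun i => (resetFirst P.blank P.alice.op i).onPart
          (part₀ P.alice.Mem P₁.alice.Mem P₂.alice.Mem P.Msg P₁.Msg P₂.Msg)) C
        (B.init ⊗ₖ ket (P.blank, P₁.blank, P₂.blank)) i) =
      (((P.alice.op i).onPart
        (part₀ P.alice.Mem P₁.alice.Mem P₂.alice.Mem P.Msg P₁.Msg P₂.Msg)).onPart
        (aliceView (AliceMem P P₁ P₂) (CombMsg P P₁ P₂) B.Mem)).apply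
      (combState P P₁ P₂ B i) := by
    intro i hi
    induction i with
    | zero =>
      have h0 : ((B.init ⊗ₖ ket (P.blank, P₁.blank, P₂.blank)) ⊗ₖ
          (P.alice.init ⊗ₖ (P₁.alice.init ⊗ₖ P₂.alice.init))).submatrix
            (bobView (AliceMem P P₁ P₂) (CombMsg P P₁ P₂) B.Mem)
            (bobView (AliceMem P P₁ P₂) (CombMsg P P₁ P₂) B.Mem) =
          combState P P₁ P₂ B 0 := by
        ext a b
        simp only [combState, run, Matrix.submatrix_apply, Matrix.kroneckerMap_apply, bobView,
          Equiv.coe_fn_mk]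
        ring
      -- At the start the message is blank, so the reset in `resetFirst` has no effect.
      change (((((Channel.reset P.blank).onPart (Equiv.prodComm P.alice.Mem P.Msg)).andThen
        (P.alice.op 0)).onPart _).onPart _).apply _ = _
      rw [Channel.onPart_onPart_apply_eq, Channel.onPart_andThen_apply,
        Channel.onPart_onPart_apply_eq (Channel.reset _),
        Channel.onPart_onPart_apply_eq (P.alice.op 0)]
      congr 1
      rw [against, run, h0, Channel.reset_onPart_apply_of_supported]
      intro a b h
      simp only [combState, run, Matrix.kroneckerMap_apply, ket, Matrix.single_apply] at h
      have h2 : (P.blank, P₁.blank, P₂.blank) = a.1.2 ∧ (P.blank, P₁.blank, P₂.blank) = b.1.2 := by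
        by_contra h3
        rw [if_neg h3] at h
        simp at h
      exact ⟨congrArg Prod.fst h2.1.symm, congrArg Prod.fst h2.2.symm⟩
    | succ i ih =>
      have hi' : i < P.rounds := by omega
      have h1 : C i = B.op i := if_pos hi'
      rw [against, run, ← against, ih hi'.le, combState_succ, combFinal, combAliceOp_of_lt hi', h1]
      rfl
  rw [against, run, ← against, key P.rounds le_rfl, afterFirst]
  -- The reset touches message registers only, so it does not matter whose operation it is; it
  -- serves as the opponent's last action of the first stage.
  have h1 : C P.rounds = (Channel.reset (P₁.blank, P₂.blank)).onPart
    (otherMsgs B.Mem P.Msg P₁.Msg P₂.Msg) := if_neg (lt_irrefl _)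
  rw [h1, Channel.onPart_onPart_apply_eq]
  exact Channel.onPart_onPart_apply (Channel.reset (P₁.blank, P₂.blank)) (fun _ => rfl)
    (fun s t => by simp [subpart, partMsgs, aliceView, bobView, otherMsgs, Prod.ext_iff]; tauto) _

theorem probBoth_comb_alice_le {n : ℕ} (hn₁ : P₁.rounds = n) (hn₂ : P₂.rounds = n) {c : Outcome}
    (hc : c ≠ Outcome.abort) {v₁ v₂ : ℝ}
    (h₁ : ∀ B, probBoth P₁.rounds P₁.blank P₁.alice B c ≤ v₁)
    (h₂ : ∀ B, probBoth P₂.rounds P₂.blank P₂.alice B c ≤ v₂) (B : Player (CombMsg P P₁ P₂)) :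
    ∃ p₀ p₁ : ℝ, 0 ≤ p₀ ∧ 0 ≤ p₁ ∧ p₀ + p₁ ≤ 1 ∧
      (∀ w, (∀ B, probBoth P.rounds P.blank P.alice B Outcome.zero ≤ w) → p₀ ≤ w) ∧
      (∀ w, (∀ B, probBoth P.rounds P.blank P.alice B Outcome.one ≤ w) → p₁ ≤ w) ∧
      probBoth (comb P P₁ P₂).rounds (comb P P₁ P₂).blank (comb P P₁ P₂).alice B c ≤
        v₂ * p₀ + v₁ * p₁ := by
  have hr : (comb P P₁ P₂).rounds = P.rounds + n := by simp [comb, hn₁, hn₂]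
  have hσ : IsDensity (B.init ⊗ₖ ket (P.blank, P₁.blank, P₂.blank)) :=
    B.init_isDensity.kronecker (ket_isDensity (comb P P₁ P₂).blank)
  rw [hn₁] at h₁
  rw [hn₂] at h₂
  obtain ⟨p₀, p₁, h0, h1, h01, hw0, hw1, hle⟩ := weight_comb_le P.alice P₁.alice P₂.alice
    (resetFirst P.blank P.alice.op) (resetFirst P₁.blank P₁.alice.op)
    (resetFirst P₂.blank P₂.alice.op) (P.rounds + 1) hc (bounded_alice h₁) (bounded_alice h₂)
    (fun i => if i < P.rounds then B.op i else
        (Channel.reset (P₁.blank, P₂.blank)).onPart (otherMsgs B.Mem P.Msg P₁.Msg P₂.Msg))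
    (fun i => B.op (P.rounds + i)) hσ
  refine ⟨p₀, p₁, h0, h1, h01, fun w hw => hw0 w (bounded_alice hw),
    fun w hw => hw1 w (bounded_alice hw), ?_⟩
  refine (probBoth_le_weight_alice _ _ _ _ _).trans (le_trans (le_of_eq ?_) hle)
  -- The run in `hle` has `n + 1` rounds and ends with an extra action `B.op (P.rounds + n)`, which
  -- leaves the statistics of Alice's memory unchanged.
  rw [hr, combFinal_eq_finalState, combFinal_add hn₁ hn₂ B le_rfl, ← afterFirst_eq_against, run,
    weight_onPart_apply (B.op (P.rounds + n))
      (bobView (AliceMem P P₁ P₂) (CombMsg P P₁ P₂) B.Mem) _ (fun a b hab => by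
        have : a.1.1 = b.1.1 := hab
        rw [this])]
  have key : ∀ j, ((branch P.alice P₁.alice P₂.alice (resetFirst P₁.blank P₁.alice.op j)
        (resetFirst P₂.blank P₂.alice.op j)).onPart
        (aliceView (AliceMem P P₁ P₂) (CombMsg P P₁ P₂) B.Mem)).apply
      (run (fun i => (branch P.alice P₁.alice P₂.alice (resetFirst P₁.blank P₁.alice.op i)
          (resetFirst P₂.blank P₂.alice.op i)).onPart
          (aliceView (AliceMem P P₁ P₂) (CombMsg P P₁ P₂) B.Mem))
        (fun i => (B.op (P.rounds + i)).onPart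
          (bobView (AliceMem P P₁ P₂) (CombMsg P P₁ P₂) B.Mem)) (afterFirst P P₁ P₂ B) j) =
      ((branch P.alice P₁.alice P₂.alice (P₁.alice.op j) (P₂.alice.op j)).onPart
        (aliceView (AliceMem P P₁ P₂) (CombMsg P P₁ P₂) B.Mem)).apply
      (run (fun i => (branch P.alice P₁.alice P₂.alice (P₁.alice.op i) (P₂.alice.op i)).onPart
          (aliceView (AliceMem P P₁ P₂) (CombMsg P P₁ P₂) B.Mem))
        (fun i => (B.op (P.rounds + i)).onPart
          (bobView (AliceMem P P₁ P₂) (CombMsg P P₁ P₂) B.Mem)) (afterFirst P P₁ P₂ B) j) := by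
    intro j
    induction j with
    | zero =>
      exact branch_reset_apply P.alice P₁.alice P₂.alice (P₁.alice.op 0) (P₂.alice.op 0) _ _ _
        (afterFirst_supported B)
    | succ j ih =>
      rw [run, run, ih]
      rfl
  rw [key]
  rfl

end Alice

theorem ket_prod_apply {S T : Type} [Fintype S] [DecidableEq S] [Fintype T] [DecidableEq T]
    (s : S) (t : T) (a b : S × T) : ket (s, t) a b = ket s a.1 b.1 * ket t a.2 b.2 := by
  simp only [ket, Matrix.single_apply, Prod.ext_iff, ite_zero_mul_ite_zero, one_mul]
  congr 1
  simp only [eq_iff_iff]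
  tauto

/-! ### Honest execution of `Comb`. -/

section Honest

variable (P P₁ P₂ : Protocol)

/-- The memory of honest Bob in `Comb(P₁, P₂)`. -/
abbrev BobMem : Type := CombMem P.bob P₁.bob P₂.bob

/-- The systems of the first protocol, apart from everything else. -/
def firstView : (AliceMem P P₁ P₂ × CombMsg P P₁ P₂) × BobMem P P₁ P₂ ≃
    ((P.alice.Mem × P.Msg) × P.bob.Mem) ×
      ((P₁.alice.Mem × P₂.alice.Mem) × ((P₁.Msg × P₂.Msg) × (P₁.bob.Mem × P₂.bob.Mem))) where
  toFun s := (((s.1.1.1, s.1.2.1), s.2.1), (s.1.1.2, (s.1.2.2, s.2.2)))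
  invFun t := (((t.1.1.1, t.2.1), (t.1.1.2, t.2.2.1)), (t.1.2, t.2.2.2))
  left_inv _ := rfl
  right_inv _ := rfl

/-- The systems of the second protocol, apart from everything else. -/
def secondView : (AliceMem P P₁ P₂ × CombMsg P P₁ P₂) × BobMem P P₁ P₂ ≃
    ((P₁.alice.Mem × P₁.Msg) × P₁.bob.Mem) ×
      (((P.alice.Mem × P.Msg) × P.bob.Mem) × ((P₂.alice.Mem × P₂.Msg) × P₂.bob.Mem)) where
  toFun s := (((s.1.1.2.1, s.1.2.2.1), s.2.2.1),
    (((s.1.1.1, s.1.2.1), s.2.1), ((s.1.1.2.2, s.1.2.2.2), s.2.2.2)))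
  invFun t := (((t.2.1.1.1, (t.1.1.1, t.2.2.1.1)), (t.2.1.1.2, (t.1.1.2, t.2.2.1.2))),
    (t.2.1.2, (t.1.2, t.2.2.2)))
  left_inv _ := rfl
  right_inv _ := rfl

/-- The systems of the third protocol, apart from everything else. -/
def thirdView : (AliceMem P P₁ P₂ × CombMsg P P₁ P₂) × BobMem P P₁ P₂ ≃
    ((P₂.alice.Mem × P₂.Msg) × P₂.bob.Mem) ×
      (((P.alice.Mem × P.Msg) × P.bob.Mem) × ((P₁.alice.Mem × P₁.Msg) × P₁.bob.Mem)) where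
  toFun s := (((s.1.1.2.2, s.1.2.2.2), s.2.2.2),
    (((s.1.1.1, s.1.2.1), s.2.1), ((s.1.1.2.1, s.1.2.2.1), s.2.2.1)))
  invFun t := (((t.2.1.1.1, (t.2.2.1.1, t.1.1.1)), (t.2.1.1.2, (t.2.2.1.2, t.1.1.2))),
    (t.2.1.2, (t.2.2.2, t.1.2)))
  left_inv _ := rfl
  right_inv _ := rfl

/-- The initial state of a protocol. -/
def start : Matrix ((P.alice.Mem × P.Msg) × P.bob.Mem) ((P.alice.Mem × P.Msg) × P.bob.Mem) ℂ :=
  (P.alice.init ⊗ₖ ket P.blank) ⊗ₖ P.bob.init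

theorem start_isDensity : IsDensity (start P) :=
  (P.alice.init_isDensity.kronecker (ket_isDensity P.blank)).kronecker P.bob.init_isDensity

/-- The state of the idle systems while the first protocol runs. -/
def idleState : Matrix
    ((P₁.alice.Mem × P₂.alice.Mem) × ((P₁.Msg × P₂.Msg) × (P₁.bob.Mem × P₂.bob.Mem)))
    ((P₁.alice.Mem × P₂.alice.Mem) × ((P₁.Msg × P₂.Msg) × (P₁.bob.Mem × P₂.bob.Mem))) ℂ :=
  (P₁.alice.init ⊗ₖ P₂.alice.init) ⊗ₖ
    (ket (P₁.blank, P₂.blank) ⊗ₖ (P₁.bob.init ⊗ₖ P₂.bob.init))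

variable {P P₁ P₂}

theorem combBobOp_of_lt {i : ℕ} (hi : i < P.rounds) :
    combBobOp P P₁ P₂ i = (P.bob.op i).onPart
      (part₀ P.bob.Mem P₁.bob.Mem P₂.bob.Mem P.Msg P₁.Msg P₂.Msg) := by
  simp only [combBobOp, bobStep, if_pos hi]

theorem combBobOp_add {n : ℕ} (hn₁ : P₁.rounds = n) (hn₂ : P₂.rounds = n) {i : ℕ} (hi : i < n) :
    combBobOp P P₁ P₂ (P.rounds + i) =
      branch P.bob P₁.bob P₂.bob (P₁.bob.op i) (P₂.bob.op i) := by
  rw [combBobOp, if_neg (by omega), Nat.add_sub_cancel_left, bobStep, bobStep,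
    if_pos (by omega), if_pos (by omega)]

theorem onPart_alice_firstView (Φ : Channel (P.alice.Mem × P.Msg))
    (σ : Matrix ((P.alice.Mem × P.Msg) × P.bob.Mem) ((P.alice.Mem × P.Msg) × P.bob.Mem) ℂ) :
    ((Φ.onPart (part₀ P.alice.Mem P₁.alice.Mem P₂.alice.Mem P.Msg P₁.Msg P₂.Msg)).onPart
      (aliceView (AliceMem P P₁ P₂) (CombMsg P P₁ P₂) (BobMem P P₁ P₂))).apply
        ((σ ⊗ₖ idleState P₁ P₂).submatrix (firstView P P₁ P₂) (firstView P P₁ P₂)) =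
      ((Φ.onPart (aliceView P.alice.Mem P.Msg P.bob.Mem)).apply σ ⊗ₖ idleState P₁ P₂).submatrix
        (firstView P P₁ P₂) (firstView P P₁ P₂) := by
  rw [Channel.onPart_onPart_apply_eq]
  exact Channel.onPart_apply_kronecker Φ (fun _ => rfl)
    (fun s t => by simp [subpart, part₀, aliceView, firstView, Prod.ext_iff]; tauto) _ _

theorem onPart_bob_firstView (Φ : Channel (P.bob.Mem × P.Msg))
    (σ : Matrix ((P.alice.Mem × P.Msg) × P.bob.Mem) ((P.alice.Mem × P.Msg) × P.bob.Mem) ℂ) :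
    ((Φ.onPart (part₀ P.bob.Mem P₁.bob.Mem P₂.bob.Mem P.Msg P₁.Msg P₂.Msg)).onPart
      (bobView (AliceMem P P₁ P₂) (CombMsg P P₁ P₂) (BobMem P P₁ P₂))).apply
        ((σ ⊗ₖ idleState P₁ P₂).submatrix (firstView P P₁ P₂) (firstView P P₁ P₂)) =
      ((Φ.onPart (bobView P.alice.Mem P.Msg P.bob.Mem)).apply σ ⊗ₖ idleState P₁ P₂).submatrix
        (firstView P P₁ P₂) (firstView P P₁ P₂) := by
  rw [Channel.onPart_onPart_apply_eq]
  exact Channel.onPart_apply_kronecker Φ (fun _ => rfl)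
    (fun s t => by simp [subpart, part₀, bobView, firstView, Prod.ext_iff]; tauto) _ _

/-- Honest players leave the idle systems in `idleState`, whose registers are blank, so the reset at
the handover changes nothing. -/
theorem afterFirst_honest : afterFirst P P₁ P₂ (comb P P₁ P₂).bob =
    (finalState P.rounds P.blank P.alice P.bob ⊗ₖ idleState P₁ P₂).submatrix
      (firstView P P₁ P₂) (firstView P P₁ P₂) := by
  have h0 : (((P.alice.init ⊗ₖ (P₁.alice.init ⊗ₖ P₂.alice.init)) ⊗ₖ
      ket (P.blank, P₁.blank, P₂.blank)) ⊗ₖ (P.bob.init ⊗ₖ (P₁.bob.init ⊗ₖ P₂.bob.init))) =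
      (start P ⊗ₖ idleState P₁ P₂).submatrix (firstView P P₁ P₂) (firstView P P₁ P₂) := by
    ext a b
    simp only [start, idleState, Matrix.submatrix_apply, Matrix.kroneckerMap_apply, firstView,
      Equiv.coe_fn_mk, ket_prod_apply]
    ring
  have h1 : run (fun i => (combAliceOp P P₁ P₂ i).onPart
        (aliceView (AliceMem P P₁ P₂) (CombMsg P P₁ P₂) (BobMem P P₁ P₂)))
      (fun i => (combBobOp P P₁ P₂ i).onPart
        (bobView (AliceMem P P₁ P₂) (CombMsg P P₁ P₂) (BobMem P P₁ P₂)))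
      ((start P ⊗ₖ idleState P₁ P₂).submatrix (firstView P P₁ P₂) (firstView P P₁ P₂))
      P.rounds =
      (stateAfter P.blank P.alice P.bob P.rounds ⊗ₖ idleState P₁ P₂).submatrix
        (firstView P P₁ P₂) (firstView P P₁ P₂) := by
    rw [stateAfter_eq_run]
    exact run_intertwine (fun σ => (σ ⊗ₖ idleState P₁ P₂).submatrix (firstView P P₁ P₂)
      (firstView P P₁ P₂))
      (fun i hi σ => by rw [combAliceOp_of_lt hi]; exact onPart_alice_firstView _ _)
      (fun i hi σ => by rw [combBobOp_of_lt hi]; exact onPart_bob_firstView _ _) _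
  have h2 : combState P P₁ P₂ (comb P P₁ P₂).bob P.rounds =
      (stateAfter P.blank P.alice P.bob P.rounds ⊗ₖ idleState P₁ P₂).submatrix
        (firstView P P₁ P₂) (firstView P P₁ P₂) := by
    rw [← h1, ← h0]
    rfl
  have h3 : afterFirst P P₁ P₂ (comb P P₁ P₂).bob = (((Channel.reset (P₁.blank, P₂.blank)).onPart
      (partMsgs P.alice.Mem P₁.alice.Mem P₂.alice.Mem P.Msg P₁.Msg P₂.Msg)).onPart
        (aliceView (AliceMem P P₁ P₂) (CombMsg P P₁ P₂) (BobMem P P₁ P₂))).apply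
      ((finalState P.rounds P.blank P.alice P.bob ⊗ₖ idleState P₁ P₂).submatrix
        (firstView P P₁ P₂) (firstView P P₁ P₂)) :=
    congrArg (Channel.apply _)
      ((congrArg (Channel.apply _) h2).trans (onPart_alice_firstView _ _))
  refine h3.trans ?_
  rw [Channel.onPart_onPart_apply_eq]
  refine Channel.reset_onPart_apply_of_supported _ _ fun a b h => ?_
  by_contra h3
  refine h ?_
  have h4 : (ket (P₁.blank, P₂.blank) : Matrix _ _ ℂ) a.1.2.2 b.1.2.2 = 0 := by
    rw [ket, Matrix.single_apply, if_neg]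
    exact fun h5 => h3 ⟨h5.1.symm, h5.2.symm⟩
  change _ * (_ * (ket (P₁.blank, P₂.blank) a.1.2.2 b.1.2.2 * _)) = (0 : ℂ)
  rw [h4]
  simp

variable (P P₁ P₂) in
/-- The joint state at the end of `Comb(P₁, P₂)` when both players are honest. -/
def honestFinal (n : ℕ) :
    Matrix ((AliceMem P P₁ P₂ × CombMsg P P₁ P₂) × BobMem P P₁ P₂)
      ((AliceMem P P₁ P₂ × CombMsg P P₁ P₂) × BobMem P P₁ P₂) ℂ :=
  ((branch P.alice P₁.alice P₂.alice (P₁.alice.op n) (P₂.alice.op n)).onPart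
      (aliceView (AliceMem P P₁ P₂) (CombMsg P P₁ P₂) (BobMem P P₁ P₂))).apply
    (run (fun i => (branch P.alice P₁.alice P₂.alice (P₁.alice.op i) (P₂.alice.op i)).onPart
        (aliceView (AliceMem P P₁ P₂) (CombMsg P P₁ P₂) (BobMem P P₁ P₂)))
      (fun i => (branch P.bob P₁.bob P₂.bob (P₁.bob.op i) (P₂.bob.op i)).onPart
        (bobView (AliceMem P P₁ P₂) (CombMsg P P₁ P₂) (BobMem P P₁ P₂)))
      ((finalState P.rounds P.blank P.alice P.bob ⊗ₖ idleState P₁ P₂).submatrix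
        (firstView P P₁ P₂) (firstView P P₁ P₂)) n)

theorem finalState_comb_honest {n : ℕ} (hn₁ : P₁.rounds = n) (hn₂ : P₂.rounds = n) :
    finalState (P.rounds + n) (comb P P₁ P₂).blank (comb P P₁ P₂).alice (comb P P₁ P₂).bob =
      honestFinal P P₁ P₂ n := by
  refine (combFinal_eq_finalState _ _).trans ((combFinal_add hn₁ hn₂ _ le_rfl).trans ?_)
  refine congrArg (Channel.apply _) ((congrArg (fun ρ => run _ _ ρ n) afterFirst_honest).trans
    (run_congr (fun i _ => rfl) (fun i hi => ?_) _))
  exact congrArg (Channel.onPart _) (combBobOp_add hn₁ hn₂ hi)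

theorem onPart_alice_thirdView (Φ : Channel (P₂.alice.Mem × P₂.Msg))
    (σ : Matrix ((P₂.alice.Mem × P₂.Msg) × P₂.bob.Mem)
      ((P₂.alice.Mem × P₂.Msg) × P₂.bob.Mem) ℂ)
    (κ : Matrix (((P.alice.Mem × P.Msg) × P.bob.Mem) × ((P₁.alice.Mem × P₁.Msg) × P₁.bob.Mem))
      (((P.alice.Mem × P.Msg) × P.bob.Mem) × ((P₁.alice.Mem × P₁.Msg) × P₁.bob.Mem)) ℂ) :
    ((Φ.onPart (part₂ P.alice.Mem P₁.alice.Mem P₂.alice.Mem P.Msg P₁.Msg P₂.Msg)).onPart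
      (aliceView (AliceMem P P₁ P₂) (CombMsg P P₁ P₂) (BobMem P P₁ P₂))).apply
        ((σ ⊗ₖ κ).submatrix (thirdView P P₁ P₂) (thirdView P P₁ P₂)) =
      ((Φ.onPart (aliceView P₂.alice.Mem P₂.Msg P₂.bob.Mem)).apply σ ⊗ₖ κ).submatrix
        (thirdView P P₁ P₂) (thirdView P P₁ P₂) := by
  rw [Channel.onPart_onPart_apply_eq]
  exact Channel.onPart_apply_kronecker Φ (fun _ => rfl)
    (fun s t => by simp [subpart, part₂, aliceView, thirdView, Prod.ext_iff]; tauto) _ _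

theorem onPart_bob_thirdView (Φ : Channel (P₂.bob.Mem × P₂.Msg))
    (σ : Matrix ((P₂.alice.Mem × P₂.Msg) × P₂.bob.Mem)
      ((P₂.alice.Mem × P₂.Msg) × P₂.bob.Mem) ℂ)
    (κ : Matrix (((P.alice.Mem × P.Msg) × P.bob.Mem) × ((P₁.alice.Mem × P₁.Msg) × P₁.bob.Mem))
      (((P.alice.Mem × P.Msg) × P.bob.Mem) × ((P₁.alice.Mem × P₁.Msg) × P₁.bob.Mem)) ℂ) :
    ((Φ.onPart (part₂ P.bob.Mem P₁.bob.Mem P₂.bob.Mem P.Msg P₁.Msg P₂.Msg)).onPart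
      (bobView (AliceMem P P₁ P₂) (CombMsg P P₁ P₂) (BobMem P P₁ P₂))).apply
        ((σ ⊗ₖ κ).submatrix (thirdView P P₁ P₂) (thirdView P P₁ P₂)) =
      ((Φ.onPart (bobView P₂.alice.Mem P₂.Msg P₂.bob.Mem)).apply σ ⊗ₖ κ).submatrix
        (thirdView P P₁ P₂) (thirdView P P₁ P₂) := by
  rw [Channel.onPart_onPart_apply_eq]
  exact Channel.onPart_apply_kronecker Φ (fun _ => rfl)
    (fun s t => by simp [subpart, part₂, bobView, thirdView, Prod.ext_iff]; tauto) _ _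

/-- Conditioned on both outputs of `P` being 0, both players run `P₂` on fresh systems. The state is
then a product of an honest run of `P₂` and a spectator whose trace is the probability of the
condition, so the probabilities multiply. -/
theorem weight_honestFinal_zero (n : ℕ) (c : Outcome) :
    weight (fun s => (P.alice.out s.1.1.1 = Outcome.zero ∧ P.bob.out s.2.1 = Outcome.zero) ∧
        (P₂.alice.out s.1.1.2.2 = c ∧ P₂.bob.out s.2.2.2 = c)) (honestFinal P P₁ P₂ n) =
      probBoth n P₂.blank P₂.alice P₂.bob c *
        probBoth P.rounds P.blank P.alice P.bob Outcome.zero := by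
  let q : (AliceMem P P₁ P₂ × CombMsg P P₁ P₂) × BobMem P P₁ P₂ → Prop :=
    fun s => P.alice.out s.1.1.1 = Outcome.zero ∧ P.bob.out s.2.1 = Outcome.zero
  let q' : (P.alice.Mem × P.Msg) × P.bob.Mem → Prop :=
    fun s => P.alice.out s.1.1 = Outcome.zero ∧ P.bob.out s.2 = Outcome.zero
  let _ : DecidablePred q := fun s => instDecidableAnd
  let _ : DecidablePred q' := fun s => instDecidableAnd
  -- The spectator: the conditioned final state of `P`, next to the untouched initial state of `P₁`.
  let κ := restrict q' (finalState P.rounds P.blank P.alice P.bob) ⊗ₖ start P₁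
  have hκ : κ.PosSemidef :=
    (restrict_posSemidef _ (finalState_isDensity _ _ _ _).posSemidef).kronecker
      (start_isDensity P₁).posSemidef
  have hκt : κ.trace.re = probBoth P.rounds P.blank P.alice P.bob Outcome.zero := by
    rw [Matrix.trace_kronecker, (start_isDensity P₁).trace_eq, mul_one, trace_restrict]
    rfl
  have h0 : restrict q ((finalState P.rounds P.blank P.alice P.bob ⊗ₖ idleState P₁ P₂).submatrix
      (firstView P P₁ P₂) (firstView P P₁ P₂)) =
      (start P₂ ⊗ₖ κ).submatrix (thirdView P P₁ P₂) (thirdView P P₁ P₂) := by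
    ext a b
    have hq : ∀ s, q s = q' (firstView P P₁ P₂ s).1 := fun _ => rfl
    simp only [κ, restrict_apply, hq, start, idleState, Matrix.submatrix_apply,
      Matrix.kroneckerMap_apply, firstView, thirdView, Equiv.coe_fn_mk, ket_prod_apply]
    split_ifs <;> ring
  have h1 : restrict q (honestFinal P P₁ P₂ n) =
      (finalState n P₂.blank P₂.alice P₂.bob ⊗ₖ κ).submatrix
        (thirdView P P₁ P₂) (thirdView P P₁ P₂) := by
    -- `q` involves both players' outputs of `P`. For an acting player one of them lies in its own
    -- memory of `P` and the other outside its part, so `q` commutes with the step, and forces the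
    -- branch of `P₂`.
    have hA : ∀ i ρ, ((((P₂.alice.op i)).onPart
        (part₂ P.alice.Mem P₁.alice.Mem P₂.alice.Mem P.Msg P₁.Msg P₂.Msg)).onPart
        (aliceView (AliceMem P P₁ P₂) (CombMsg P P₁ P₂) (BobMem P P₁ P₂))).apply (restrict q ρ) =
        restrict q (((branch P.alice P₁.alice P₂.alice (P₁.alice.op i) (P₂.alice.op i)).onPart
          (aliceView (AliceMem P P₁ P₂) (CombMsg P P₁ P₂) (BobMem P P₁ P₂))).apply ρ) :=
      fun i ρ => (restrict_branch_zero P.alice P₁.alice P₂.alice _ _ _ q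
        (fun a b h h' => by
          change a.1.1.1 = b.1.1.1 at h
          change a.2 = b.2 at h'
          simp only [q, h, h']) (fun s hs => hs.1) ρ).symm
    have hB : ∀ i ρ, ((((P₂.bob.op i)).onPart
        (part₂ P.bob.Mem P₁.bob.Mem P₂.bob.Mem P.Msg P₁.Msg P₂.Msg)).onPart
        (bobView (AliceMem P P₁ P₂) (CombMsg P P₁ P₂) (BobMem P P₁ P₂))).apply (restrict q ρ) =
        restrict q (((branch P.bob P₁.bob P₂.bob (P₁.bob.op i) (P₂.bob.op i)).onPart
          (bobView (AliceMem P P₁ P₂) (CombMsg P P₁ P₂) (BobMem P P₁ P₂))).apply ρ) :=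
      fun i ρ => (restrict_branch_zero P.bob P₁.bob P₂.bob _ _ _ q
        (fun a b h h' => by
          change a.2.1 = b.2.1 at h
          change a.1.1 = b.1.1 at h'
          simp only [q, h, h']) (fun s hs => hs.2) ρ).symm
    rw [honestFinal, ← hA, ← run_intertwine (restrict q) (fun i _ ρ => hA i ρ)
      (fun i _ ρ => hB i ρ), h0, run_intertwine (F := fun i => (P₂.alice.op i).onPart
          (aliceView P₂.alice.Mem P₂.Msg P₂.bob.Mem))
        (G := fun i => (P₂.bob.op i).onPart (bobView P₂.alice.Mem P₂.Msg P₂.bob.Mem))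
        (fun σ => (σ ⊗ₖ κ).submatrix (thirdView P P₁ P₂) (thirdView P P₁ P₂))
        (fun i _ σ => onPart_alice_thirdView _ _ _) (fun i _ σ => onPart_bob_thirdView _ _ _),
      onPart_alice_thirdView, finalState, stateAfter_eq_run]
    rfl
  refine (weight_restrict (fun s => P₂.alice.out s.1.1.2.2 = c ∧ P₂.bob.out s.2.2.2 = c)
    q _).symm.trans ?_
  rw [h1, ← hκt]
  refine (weight_submatrix (fun s => P₂.alice.out s.1.1.1 = c ∧ P₂.bob.out s.1.2 = c)
    (thirdView P P₁ P₂) _).trans ?_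
  exact weight_kronecker (fun s : (P₂.alice.Mem × P₂.Msg) × P₂.bob.Mem =>
    P₂.alice.out s.1.1 = c ∧ P₂.bob.out s.2 = c) _ hκ

theorem onPart_alice_secondView (Φ : Channel (P₁.alice.Mem × P₁.Msg))
    (σ : Matrix ((P₁.alice.Mem × P₁.Msg) × P₁.bob.Mem)
      ((P₁.alice.Mem × P₁.Msg) × P₁.bob.Mem) ℂ)
    (κ : Matrix (((P.alice.Mem × P.Msg) × P.bob.Mem) × ((P₂.alice.Mem × P₂.Msg) × P₂.bob.Mem))
      (((P.alice.Mem × P.Msg) × P.bob.Mem) × ((P₂.alice.Mem × P₂.Msg) × P₂.bob.Mem)) ℂ) :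
    ((Φ.onPart (part₁ P.alice.Mem P₁.alice.Mem P₂.alice.Mem P.Msg P₁.Msg P₂.Msg)).onPart
      (aliceView (AliceMem P P₁ P₂) (CombMsg P P₁ P₂) (BobMem P P₁ P₂))).apply
        ((σ ⊗ₖ κ).submatrix (secondView P P₁ P₂) (secondView P P₁ P₂)) =
      ((Φ.onPart (aliceView P₁.alice.Mem P₁.Msg P₁.bob.Mem)).apply σ ⊗ₖ κ).submatrix
        (secondView P P₁ P₂) (secondView P P₁ P₂) := by
  rw [Channel.onPart_onPart_apply_eq]
  exact Channel.onPart_apply_kronecker Φ (fun _ => rfl)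
    (fun s t => by simp [subpart, part₁, aliceView, secondView, Prod.ext_iff]; tauto) _ _

theorem onPart_bob_secondView (Φ : Channel (P₁.bob.Mem × P₁.Msg))
    (σ : Matrix ((P₁.alice.Mem × P₁.Msg) × P₁.bob.Mem)
      ((P₁.alice.Mem × P₁.Msg) × P₁.bob.Mem) ℂ)
    (κ : Matrix (((P.alice.Mem × P.Msg) × P.bob.Mem) × ((P₂.alice.Mem × P₂.Msg) × P₂.bob.Mem))
      (((P.alice.Mem × P.Msg) × P.bob.Mem) × ((P₂.alice.Mem × P₂.Msg) × P₂.bob.Mem)) ℂ) :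
    ((Φ.onPart (part₁ P.bob.Mem P₁.bob.Mem P₂.bob.Mem P.Msg P₁.Msg P₂.Msg)).onPart
      (bobView (AliceMem P P₁ P₂) (CombMsg P P₁ P₂) (BobMem P P₁ P₂))).apply
        ((σ ⊗ₖ κ).submatrix (secondView P P₁ P₂) (secondView P P₁ P₂)) =
      ((Φ.onPart (bobView P₁.alice.Mem P₁.Msg P₁.bob.Mem)).apply σ ⊗ₖ κ).submatrix
        (secondView P P₁ P₂) (secondView P P₁ P₂) := by
  rw [Channel.onPart_onPart_apply_eq]
  exact Channel.onPart_apply_kronecker Φ (fun _ => rfl)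
    (fun s t => by simp [subpart, part₁, bobView, secondView, Prod.ext_iff]; tauto) _ _

theorem weight_honestFinal_one (n : ℕ) (c : Outcome) :
    weight (fun s => (P.alice.out s.1.1.1 = Outcome.one ∧ P.bob.out s.2.1 = Outcome.one) ∧
        (P₁.alice.out s.1.1.2.1 = c ∧ P₁.bob.out s.2.2.1 = c)) (honestFinal P P₁ P₂ n) =
      probBoth n P₁.blank P₁.alice P₁.bob c *
        probBoth P.rounds P.blank P.alice P.bob Outcome.one := by
  let q : (AliceMem P P₁ P₂ × CombMsg P P₁ P₂) × BobMem P P₁ P₂ → Prop :=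
    fun s => P.alice.out s.1.1.1 = Outcome.one ∧ P.bob.out s.2.1 = Outcome.one
  let q' : (P.alice.Mem × P.Msg) × P.bob.Mem → Prop :=
    fun s => P.alice.out s.1.1 = Outcome.one ∧ P.bob.out s.2 = Outcome.one
  let _ : DecidablePred q := fun s => instDecidableAnd
  let _ : DecidablePred q' := fun s => instDecidableAnd
  let κ := restrict q' (finalState P.rounds P.blank P.alice P.bob) ⊗ₖ start P₂
  have hκ : κ.PosSemidef :=
    (restrict_posSemidef _ (finalState_isDensity _ _ _ _).posSemidef).kronecker
      (start_isDensity P₂).posSemidef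
  have hκt : κ.trace.re = probBoth P.rounds P.blank P.alice P.bob Outcome.one := by
    rw [Matrix.trace_kronecker, (start_isDensity P₂).trace_eq, mul_one, trace_restrict]
    rfl
  have h0 : restrict q ((finalState P.rounds P.blank P.alice P.bob ⊗ₖ idleState P₁ P₂).submatrix
      (firstView P P₁ P₂) (firstView P P₁ P₂)) =
      (start P₁ ⊗ₖ κ).submatrix (secondView P P₁ P₂) (secondView P P₁ P₂) := by
    ext a b
    have hq : ∀ s, q s = q' (firstView P P₁ P₂ s).1 := fun _ => rfl
    simp only [κ, restrict_apply, hq, start, idleState, Matrix.submatrix_apply,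
      Matrix.kroneckerMap_apply, firstView, secondView, Equiv.coe_fn_mk, ket_prod_apply]
    split_ifs <;> ring
  have h1 : restrict q (honestFinal P P₁ P₂ n) =
      (finalState n P₁.blank P₁.alice P₁.bob ⊗ₖ κ).submatrix
        (secondView P P₁ P₂) (secondView P P₁ P₂) := by
    have hA : ∀ i ρ, ((((P₁.alice.op i)).onPart
        (part₁ P.alice.Mem P₁.alice.Mem P₂.alice.Mem P.Msg P₁.Msg P₂.Msg)).onPart
        (aliceView (AliceMem P P₁ P₂) (CombMsg P P₁ P₂) (BobMem P P₁ P₂))).apply (restrict q ρ) =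
        restrict q (((branch P.alice P₁.alice P₂.alice (P₁.alice.op i) (P₂.alice.op i)).onPart
          (aliceView (AliceMem P P₁ P₂) (CombMsg P P₁ P₂) (BobMem P P₁ P₂))).apply ρ) :=
      fun i ρ => (restrict_branch_one P.alice P₁.alice P₂.alice _ _ _ q
        (fun a b h h' => by
          change a.1.1.1 = b.1.1.1 at h
          change a.2 = b.2 at h'
          simp only [q, h, h']) (fun s hs => hs.1) ρ).symm
    have hB : ∀ i ρ, ((((P₁.bob.op i)).onPart
        (part₁ P.bob.Mem P₁.bob.Mem P₂.bob.Mem P.Msg P₁.Msg P₂.Msg)).onPart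
        (bobView (AliceMem P P₁ P₂) (CombMsg P P₁ P₂) (BobMem P P₁ P₂))).apply (restrict q ρ) =
        restrict q (((branch P.bob P₁.bob P₂.bob (P₁.bob.op i) (P₂.bob.op i)).onPart
          (bobView (AliceMem P P₁ P₂) (CombMsg P P₁ P₂) (BobMem P P₁ P₂))).apply ρ) :=
      fun i ρ => (restrict_branch_one P.bob P₁.bob P₂.bob _ _ _ q
        (fun a b h h' => by
          change a.2.1 = b.2.1 at h
          change a.1.1 = b.1.1 at h'
          simp only [q, h, h']) (fun s hs => hs.2) ρ).symm
    rw [honestFinal, ← hA, ← run_intertwine (restrict q) (fun i _ ρ => hA i ρ)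
      (fun i _ ρ => hB i ρ), h0, run_intertwine (F := fun i => (P₁.alice.op i).onPart
          (aliceView P₁.alice.Mem P₁.Msg P₁.bob.Mem))
        (G := fun i => (P₁.bob.op i).onPart (bobView P₁.alice.Mem P₁.Msg P₁.bob.Mem))
        (fun σ => (σ ⊗ₖ κ).submatrix (secondView P P₁ P₂) (secondView P P₁ P₂))
        (fun i _ σ => onPart_alice_secondView _ _ _) (fun i _ σ => onPart_bob_secondView _ _ _),
      onPart_alice_secondView, finalState, stateAfter_eq_run]
    rfl
  refine (weight_restrict (fun s => P₁.alice.out s.1.1.2.1 = c ∧ P₁.bob.out s.2.2.1 = c)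
    q _).symm.trans ?_
  rw [h1, ← hκt]
  refine (weight_submatrix (fun s => P₁.alice.out s.1.1.1 = c ∧ P₁.bob.out s.1.2 = c)
    (secondView P P₁ P₂) _).trans ?_
  exact weight_kronecker (fun s : (P₁.alice.Mem × P₁.Msg) × P₁.bob.Mem =>
    P₁.alice.out s.1.1 = c ∧ P₁.bob.out s.2 = c) _ hκ

/-- The two product events are disjoint and both lead to the common output `c`. The inequality
suffices: in `comb_isWCF` the lower bounds for 0 and 1 add up to 1. -/
theorem le_probBoth_comb {n : ℕ} (hn₁ : P₁.rounds = n) (hn₂ : P₂.rounds = n) {c : Outcome}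
    (hc : c ≠ Outcome.abort) :
    probBoth n P₂.blank P₂.alice P₂.bob c *
        probBoth P.rounds P.blank P.alice P.bob Outcome.zero +
      probBoth n P₁.blank P₁.alice P₁.bob c *
        probBoth P.rounds P.blank P.alice P.bob Outcome.one ≤
      probBoth (comb P P₁ P₂).rounds (comb P P₁ P₂).blank (comb P P₁ P₂).alice
        (comb P P₁ P₂).bob c := by
  have hr : (comb P P₁ P₂).rounds = P.rounds + n := by simp [comb, hn₁, hn₂]
  have hpos : (honestFinal P P₁ P₂ n).PosSemidef := by
    rw [← finalState_comb_honest hn₁ hn₂]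
    exact (finalState_isDensity _ _ _ _).posSemidef
  have h1 : probBoth (comb P P₁ P₂).rounds (comb P P₁ P₂).blank (comb P P₁ P₂).alice
        (comb P P₁ P₂).bob c =
      weight (fun s => combOut P.alice P₁.alice P₂.alice s.1.1 = c ∧
        combOut P.bob P₁.bob P₂.bob s.2 = c) (honestFinal P P₁ P₂ n) := by
    rw [hr, ← finalState_comb_honest hn₁ hn₂]
    rfl
  rw [h1, ← weight_honestFinal_zero n c, ← weight_honestFinal_one n c, ← weight_or]
  · refine weight_mono (fun s hs => ?_) hpos
    rw [combOut_eq_iff _ _ _ hc, combOut_eq_iff _ _ _ hc]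
    rcases hs with ⟨⟨h1, h2⟩, h3, h4⟩ | ⟨⟨h1, h2⟩, h3, h4⟩
    · exact ⟨Or.inl ⟨h1, h3⟩, Or.inl ⟨h2, h4⟩⟩
    · exact ⟨Or.inr ⟨h1, h3⟩, Or.inr ⟨h2, h4⟩⟩
  · rintro s ⟨⟨⟨h1, -⟩, -⟩, ⟨⟨h2, -⟩, -⟩⟩
    rw [h1] at h2
    cases h2

end Honest

/-! ### Elementary bounds, the bias of one combination, and the dyadic induction. -/

namespace Player

variable {M : Type} [Fintype M] [DecidableEq M]

theorem probBoth_nonneg (n : ℕ) (blank : M) (A B : Player M) (c : Outcome) :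
    0 ≤ probBoth n blank A B c :=
  weight_nonneg (fun s : (A.Mem × M) × B.Mem => A.out s.1.1 = c ∧ B.out s.2 = c)
    (finalState_isDensity n blank A B).posSemidef

theorem probBoth_add_le_one (n : ℕ) (blank : M) (A B : Player M) :
    probBoth n blank A B Outcome.zero + probBoth n blank A B Outcome.one ≤ 1 := by
  have h := finalState_isDensity n blank A B
  have h1 := weight_mono (q := fun _ => True) (p := fun s : (A.Mem × M) × B.Mem =>
    (A.out s.1.1 = Outcome.zero ∧ B.out s.2 = Outcome.zero) ∨
      (A.out s.1.1 = Outcome.one ∧ B.out s.2 = Outcome.one)) (fun _ _ => trivial) h.posSemidef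
  rw [weight_true, h.trace_eq, weight_or] at h1
  · exact h1
  · rintro s ⟨⟨h2, -⟩, ⟨h3, -⟩⟩
    rw [h2] at h3
    cases h3

theorem probBoth_eq_zero (n : ℕ) (blank : M) {A B : Player M} {c : Outcome}
    (h : (∀ a, A.out a ≠ c) ∨ ∀ b, B.out b ≠ c) : probBoth n blank A B c = 0 := by
  refine Finset.sum_eq_zero fun s _ => if_neg ?_
  rintro ⟨h1, h2⟩
  exact h.elim (fun h => h _ h1) fun h => h _ h2

theorem probBoth_eq_one (n : ℕ) (blank : M) {A B : Player M} {c : Outcome}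
    (hA : ∀ a, A.out a = c) (hB : ∀ b, B.out b = c) : probBoth n blank A B c = 1 := by
  have h : probBoth n blank A B c =
    weight (fun s => A.out s.1.1 = c ∧ B.out s.2 = c) (finalState n blank A B) := rfl
  rw [h, weight_congr (q := fun _ => True) (fun s => by simp [hA, hB]), weight_true,
    (finalState_isDensity n blank A B).trace_eq, Complex.one_re]

end Player

namespace Protocol

theorem IsWCF.mono {P : Protocol} {z ε ε' : ℝ} (h : P.IsWCF z ε) (hε : ε ≤ ε') : P.IsWCF z ε' :=
  ⟨h.honest_alice, h.honest_bob, fun A => (h.cheating_alice A).trans (by linarith),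
    fun B => (h.cheating_bob B).trans (by linarith)⟩

theorem IsWCF.nonneg {P : Protocol} {z ε : ℝ} (h : P.IsWCF z ε) : 0 ≤ ε := by
  have := h.cheating_alice P.alice
  rw [h.honest_alice] at this
  linarith

theorem const_zero_isWCF : (const Outcome.zero).IsWCF 1 0 where
  honest_alice := probBoth_eq_one _ _ (fun _ => rfl) fun _ => rfl
  honest_bob := (probBoth_eq_zero _ _ (Or.inl fun _ h => by cases h)).trans (sub_self 1).symm
  cheating_alice A := by
    have h1 : (const Outcome.zero).probAliceWins A (const Outcome.zero).bob +
        (const Outcome.zero).probBobWins A (const Outcome.zero).bob ≤ 1 :=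
      probBoth_add_le_one _ _ _ _
    have h2 : 0 ≤ (const Outcome.zero).probBobWins A (const Outcome.zero).bob :=
      probBoth_nonneg _ _ _ _ _
    linarith
  cheating_bob B := by
    have h : (const Outcome.zero).probBobWins (const Outcome.zero).alice B = 0 :=
      probBoth_eq_zero _ _ (Or.inl fun _ h => by cases h)
    rw [h]
    norm_num

theorem const_one_isWCF : (const Outcome.one).IsWCF 0 0 where
  honest_alice := probBoth_eq_zero _ _ (Or.inl fun _ h => by cases h)
  honest_bob := (probBoth_eq_one _ _ (fun _ => rfl) fun _ => rfl).trans (sub_zero 1).symm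
  cheating_alice A := by
    have h : (const Outcome.one).probAliceWins A (const Outcome.one).bob = 0 :=
      probBoth_eq_zero _ _ (Or.inr fun _ h => by cases h)
    rw [h]
    norm_num
  cheating_bob B := by
    have h1 : (const Outcome.one).probAliceWins (const Outcome.one).alice B +
        (const Outcome.one).probBobWins (const Outcome.one).alice B ≤ 1 :=
      probBoth_add_le_one _ _ _ _
    have h2 : 0 ≤ (const Outcome.one).probAliceWins (const Outcome.one).alice B :=
      probBoth_nonneg _ _ _ _ _
    linarith

theorem comb_isWCF {P P₁ P₂ : Protocol} {ε e x₁ x₂ : ℝ} {n : ℕ} (hP : P.IsWCF (1 / 2) ε)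
    (h₁ : P₁.IsWCF x₁ e) (h₂ : P₂.IsWCF x₂ e) (hn₁ : P₁.rounds = n) (hn₂ : P₂.rounds = n)
    (hx : x₁ ≤ x₂) : (comb P P₁ P₂).IsWCF ((x₁ + x₂) / 2) (e + ε * (x₂ - x₁)) := by
  have hz := le_probBoth_comb (P := P) hn₁ hn₂ (c := Outcome.zero) (by simp)
  have ho := le_probBoth_comb (P := P) hn₁ hn₂ (c := Outcome.one) (by simp)
  have hs := probBoth_add_le_one (comb P P₁ P₂).rounds (comb P P₁ P₂).blank (comb P P₁ P₂).alice
    (comb P P₁ P₂).bob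
  have a0 : probBoth P.rounds P.blank P.alice P.bob Outcome.zero = 1 / 2 := hP.honest_alice
  have a1 : probBoth P.rounds P.blank P.alice P.bob Outcome.one = 1 - 1 / 2 := hP.honest_bob
  have b0 : probBoth n P₁.blank P₁.alice P₁.bob Outcome.zero = x₁ := hn₁ ▸ h₁.honest_alice
  have b1 : probBoth n P₁.blank P₁.alice P₁.bob Outcome.one = 1 - x₁ := hn₁ ▸ h₁.honest_bob
  have c0 : probBoth n P₂.blank P₂.alice P₂.bob Outcome.zero = x₂ := hn₂ ▸ h₂.honest_alice
  have c1 : probBoth n P₂.blank P₂.alice P₂.bob Outcome.one = 1 - x₂ := hn₂ ▸ h₂.honest_bob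
  rw [a0, a1, b0, c0] at hz
  rw [a0, a1, b1, c1] at ho
  have hx1 : 0 ≤ x₁ := b0 ▸ probBoth_nonneg _ _ _ _ _
  have hx2 : 0 ≤ 1 - x₂ := c1 ▸ probBoth_nonneg _ _ _ _ _
  have he := h₁.nonneg
  refine ⟨?_, ?_, fun A => ?_, fun B => ?_⟩
  -- `hz` and `ho` have right-hand sides whose sum is at most 1 by `hs`, and left-hand sides whose
  -- sum is 1; so equality holds in both.
  · rw [probAliceWins]
    linarith
  · rw [probBobWins]
    linarith
  · obtain ⟨p₀, p₁, hp0, hp1, hp, hw, -, hle⟩ := probBoth_comb_bob_le P P₁ P₂ hn₁ hn₂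
      (c := Outcome.zero) (by simp) h₁.cheating_alice h₂.cheating_alice A
    have hw' := hw _ hP.cheating_alice
    rw [probAliceWins]
    -- The bound in `hle` is (x₂ - x₁)p₀ + (x₁ + e)(p₀ + p₁), with p₀ ≤ 1/2 + ε and p₀ + p₁ ≤ 1.
    nlinarith [mul_nonneg (sub_nonneg.2 hx) (sub_nonneg.2 hw'),
      mul_nonneg (add_nonneg hx1 he) (sub_nonneg.2 hp)]
  · obtain ⟨p₀, p₁, hp0, hp1, hp, -, hw, hle⟩ := probBoth_comb_alice_le (P := P) hn₁ hn₂
      (c := Outcome.one) (by simp) h₁.cheating_bob h₂.cheating_bob B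
    have hw' := hw _ hP.cheating_bob
    rw [probBobWins]
    -- For Bob the better continuation is `P₁`: the bound is (x₂ - x₁)p₁ + (1 - x₂ + e)(p₀ + p₁),
    -- with p₁ ≤ 1/2 + ε.
    nlinarith [mul_nonneg (sub_nonneg.2 hx) (sub_nonneg.2 hw'),
      mul_nonneg (add_nonneg hx2 he) (sub_nonneg.2 hp)]

/-- The dyadic values with denominator `2 ^ k` are attained with `k * P.rounds` rounds. -/
theorem exists_combOf_isWCF {P : Protocol} {ε : ℝ} (hP : P.IsWCF (1 / 2) ε) (k : ℕ) :
    ∀ j : ℕ, j ≤ 2 ^ k → ∃ Q : Protocol, CombOf P Q ∧ Q.rounds = k * P.rounds ∧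
      Q.IsWCF (j / 2 ^ k) (2 * ε * (1 - 1 / 2 ^ k)) := by
  induction k with
  | zero =>
    intro j hj
    interval_cases j
    · exact ⟨_, CombOf.bobWins, by simp [const], by simpa using const_one_isWCF⟩
    · exact ⟨_, CombOf.aliceWins, by simp [const], by simpa using const_zero_isWCF⟩
  | succ k ih =>
    intro j hj
    rw [pow_succ] at hj
    -- The target j/2^(k+1) is the midpoint of ⌊j/2⌋/2^k and ⌈j/2⌉/2^k, which coincide or are
    -- neighbours at level k.
    obtain ⟨Q₁, hQ₁, hr₁, hW₁⟩ := ih (j / 2) (by omega)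
    obtain ⟨Q₂, hQ₂, hr₂, hW₂⟩ := ih ((j + 1) / 2) (by omega)
    have hle : j / 2 ≤ (j + 1) / 2 := by omega
    have hle' : (j + 1) / 2 ≤ j / 2 + 1 := by omega
    have hsum : j / 2 + (j + 1) / 2 = j := by omega
    generalize j / 2 = a at *
    generalize (j + 1) / 2 = b at *
    have hpos : (0 : ℝ) < 2 ^ k := by positivity
    have hle₁ : (a : ℝ) / 2 ^ k ≤ b / 2 ^ k := by gcongr
    have hle₂ : (b : ℝ) / 2 ^ k ≤ a / 2 ^ k + 1 / 2 ^ k := by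
      rw [← add_div]
      gcongr
      exact_mod_cast hle'
    refine ⟨comb P Q₁ Q₂, CombOf.comb hQ₁ hQ₂, ?_, ?_⟩
    · simp only [comb, hr₁, hr₂, max_self]
      ring
    · have hc := comb_isWCF hP hW₁ hW₂ hr₁ hr₂ hle₁
      have hv : ((a : ℝ) / 2 ^ k + b / 2 ^ k) / 2 = (j : ℝ) / 2 ^ (k + 1) := by
        rw [← hsum, pow_succ]
        push_cast
        field_simp
      rw [hv] at hc
      refine hc.mono ?_
      -- The new bias is at most ε/2^k, the next term of the geometric series with partial sums 2ε(1
      -- - 2^(-k)).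
      have h1 : ε * ((b : ℝ) / 2 ^ k - a / 2 ^ k) ≤ ε * (1 / 2 ^ k) :=
        mul_le_mul_of_nonneg_left (by linarith) hP.nonneg
      have h2 : 2 * ε * (1 - 1 / 2 ^ (k + 1)) = 2 * ε * (1 - 1 / 2 ^ k) + ε * (1 / 2 ^ k) := by
        rw [pow_succ]
        field_simp
        ring
      linarith

end Protocol

end CoinFlip

end

theorem mainTheorem4 (P : CoinFlip.Protocol) (ε : ℝ) (N : ℕ) (hN : P.rounds = N)
    (hP : P.IsWCF (1 / 2) ε) (z : ℝ) (hz : z ∈ Set.Icc (0 : ℝ) 1) (k : ℕ) :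
    ∃ (Q : CoinFlip.Protocol) (x ε₀ : ℝ),
      CoinFlip.Protocol.CombOf P Q ∧ Q.IsWCF x ε₀ ∧ Q.rounds = k * N ∧
        |x - z| ≤ (2 : ℝ) ^ (-(k : ℤ)) ∧ ε₀ ≤ 2 * ε := by
  have hpos : (0 : ℝ) < 2 ^ k := by positivity
  have hz0 : 0 ≤ z * 2 ^ k := mul_nonneg hz.1 hpos.le
  have hfloor : (⌊z * 2 ^ k⌋₊ : ℝ) ≤ z * 2 ^ k := Nat.floor_le hz0
  have hj : ⌊z * 2 ^ k⌋₊ ≤ 2 ^ k := by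
    have : (⌊z * 2 ^ k⌋₊ : ℝ) ≤ 2 ^ k := hfloor.trans (mul_le_of_le_one_left hpos.le hz.2)
    exact_mod_cast this
  -- The value x is z rounded down to a multiple of 2^(-k); z ≤ 1 keeps the numerator at most 2^k.
  obtain ⟨Q, hQ, hr, hW⟩ := CoinFlip.Protocol.exists_combOf_isWCF hP k _ hj
  refine ⟨Q, _, _, hQ, hW, hN ▸ hr, ?_, ?_⟩
  · rw [zpow_neg, zpow_natCast, abs_sub_comm, abs_le]
    have h1 : (⌊z * 2 ^ k⌋₊ : ℝ) / 2 ^ k ≤ z := (div_le_iff₀ hpos).2 hfloor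
    have h2 : z ≤ ((⌊z * 2 ^ k⌋₊ : ℝ) + 1) / 2 ^ k :=
      (le_div_iff₀ hpos).2 (Nat.lt_floor_add_one _).le
    rw [add_div, one_div] at h2
    have h3 : (0 : ℝ) < (2 ^ k)⁻¹ := inv_pos.2 hpos
    constructor <;> linarith
  · have h1 : (0 : ℝ) < 1 / 2 ^ k := by positivity
    nlinarith [mul_nonneg hP.nonneg h1.le]
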